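/- Let $p,k\in\mathbb N_0$, let $\Omega=\prod_{i=1}^p[a_i,b_i]\subset\mathbb R^p$ (with $a_i<b_i$) be a rectangle equipped with a rectangular grid, i.e. for each $i$ there are nodes $a_i=x_{i,0}<x_{i,1}<\dots<x_{i,M_i}=b_i$ with $M_i\ge 1$, and the grid cells are the closed boxes $Q=\prod_i[x_{i,m_i},x_{i,m_i+1}]$. Fix $N\in\mathbb N\cup\{\infty\}$ with $N\ge p(k+1)$, and let $V$ be the real vector space of functions $\phi:\Omega\to\mathbb R$ that are $C^N$ on each closed grid cell and whose derivatives $\partial^{\vec\alpha}\phi$, $\vec\alpha\in\{0,\dots,k\}^p$, have no jumps: at a point common to two cells, the values computed from the two cells agree. (In particular $V$ contains all functions that are $C^N$ on $\Omega$.) For $\phi\in V$, the Hermite interpolant $\mathcal H_\phi:\Omega\to\mathbb R$ is the function that on each grid cell is a polynomial of degree at most $2k+1$ in each variable and satisfies $\partial^{\vec\alpha}\mathcal H_\phi=\partial^{\vec\alpha}\phi$ at all vertices of the cell for all $\vec\alpha\in\{0,\dots,k\}^p$ (derivatives of $\mathcal H_\phi$ being those of the polynomial of that cell). Let $\vec\beta=(k+1,\dots,k+1)$,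 let $$\mathcal F[\phi]=\int_\Omega\big(\partial^{\vec\beta}\phi(\vec x)\big)^2\,d\vec x$$ be the stability functional, and let $$B(f,g)=\int_\Omega \partial^{\vec\beta}f(\vec x)\,\partial^{\vec\beta}g(\vec x)\,d\vec x ,\qquad f,g\in V,$$ where the derivatives $\partial^{\vec\beta}$ exist in the interior of each cell, hence almost everywhere. Then the integrand in $B(f,g)$ is integrable, and $B$ is a symmetric positive semi-definite bilinear form on $V$ with $B(f,f)=\mathcal F[f]$. For every $\phi\in V$ the interpolant $\mathcal H_\phi$ exists, is unique and belongs to $V$, and the map $P:V\to V$, $\phi\mapsto\mathcal H_\phi$, is an orthogonal projection with respect to $B$: it is linear, $P^2=P$, and $B(u,v)=0$ for all $u$ in the range and all $v$ in the kernel of $P$. The orthogonality holds on every grid cell $Q$ separately: for all $f,g\in V$, $$\int_Q \partial^{\vec\beta}\mathcal H_f\;\partial^{\vec\beta}(g-\mathcal H_g)\,d\vec x=0 .$$ -/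

import Mathlib

open MeasureTheory

noncomputable section

namespace HermiteProj

/-! ### Partial derivatives -/

/-- The first order partial derivative `∂ᵢ f` in the set `s`. It is one-sided at those points of
the boundary of `s` where the line parallel to the `i`-th axis meets `s` on one side only. -/
def partialWithin {p : ℕ} (s : Set (Fin p → ℝ)) (i : Fin p) (f : (Fin p → ℝ) → ℝ) :
    (Fin p → ℝ) → ℝ :=
  fun x => lineDerivWithin ℝ f s x (Pi.single i 1)

/-- The mixed partial derivative `∂^α f = ∂₁^{α₁} ⋯ ∂ₚ^{αₚ} f` in the set `s`. -/
def mixedDeriv {p : ℕ} (s : Set (Fin p → ℝ)) (α : Fin p → ℕ) (f : (Fin p → ℝ) → ℝ) :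
    (Fin p → ℝ) → ℝ :=
  (List.finRange p).foldr (fun i g => (partialWithin s i)^[α i] g) f

/-- The extension by zero of a function on `s`. -/
def zeroExt {p : ℕ} {s : Set (Fin p → ℝ)} (f : s → ℝ) : (Fin p → ℝ) → ℝ :=
  Function.extend Subtype.val f 0

/-! ### Rectangular grids -/

/-- A rectangular (tensor product) grid in `ℝᵖ`: in the `i`-th direction it has `size i ≥ 1`
intervals, bounded by the nodes `node i 0 < node i 1 < ⋯ < node i (size i)`. -/
structure Grid (p : ℕ) where
  size : Fin p → ℕ
  size_pos : ∀ i, 0 < size i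
  node : (i : Fin p) → Fin (size i + 1) → ℝ
  node_strictMono : ∀ i, StrictMono (node i)

namespace Grid

variable {p : ℕ} (G : Grid p)

/-- The closed rectangular computational domain `Ω`. -/
def domain : Set (Fin p → ℝ) :=
  Set.Icc (fun i => G.node i 0) (fun i => G.node i (Fin.last (G.size i)))

/-- The closed grid cell with index `c`. -/
def cell (c : (i : Fin p) → Fin (G.size i)) : Set (Fin p → ℝ) :=
  Set.Icc (fun i => G.node i (c i).castSucc) (fun i => G.node i (c i).succ)

/-- The vertex with index `q ∈ {0,1}ᵖ` of the cell with index `c`. -/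
def vertex (c : (i : Fin p) → Fin (G.size i)) (q : Fin p → Fin 2) : Fin p → ℝ :=
  fun i => if q i = 0 then G.node i (c i).castSucc else G.node i (c i).succ

end Grid

/-! ### Auxiliary facts on partial derivatives in boxes -/

section aux

variable {p : ℕ}

lemma hasLineDerivWithinAt_of_contDiffOn {s : Set (Fin p → ℝ)} {n : ℕ}
    {f : (Fin p → ℝ) → ℝ} (hf : ContDiffOn ℝ ((n + 1 : ℕ) : WithTop ℕ∞) f s) {x : Fin p → ℝ}
    (hx : x ∈ s) (v : Fin p → ℝ) :
    HasLineDerivWithinAt ℝ f (fderivWithin ℝ f s x v) s x v :=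
  ((hf.differentiableOn (by simp) x hx).hasFDerivWithinAt).hasLineDerivWithinAt v

lemma uniqueDiffWithinAt_line {a b : Fin p → ℝ} (hab : ∀ i, a i < b i) {x : Fin p → ℝ}
    (hx : x ∈ Set.Icc a b) (i : Fin p) :
    UniqueDiffWithinAt ℝ ((fun t : ℝ => x + t • (Pi.single i 1 : Fin p → ℝ)) ⁻¹' Set.Icc a b)
      0 := by
  have hs : (fun t : ℝ => x + t • (Pi.single i 1 : Fin p → ℝ)) ⁻¹' Set.Icc a b =
      Set.Icc (a i - x i) (b i - x i) := by
    ext t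
    simp only [Set.mem_preimage, Set.mem_Icc, Pi.le_def, Pi.add_apply, Pi.smul_apply,
      smul_eq_mul]
    constructor
    · rintro ⟨h1, h2⟩
      have h1 := h1 i
      have h2 := h2 i
      simp at h1 h2
      constructor <;> linarith
    · rintro ⟨h1, h2⟩
      refine ⟨fun j => ?_, fun j => ?_⟩ <;> by_cases hj : j = i
      · subst hj; simp; linarith
      · simpa [Pi.single_eq_of_ne hj] using hx.1 j
      · subst hj; simp; linarith
      · simpa [Pi.single_eq_of_ne hj] using hx.2 j
  rw [hs]
  have h1 := hx.1 i
  have h2 := hx.2 i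
  have h3 := hab i
  exact uniqueDiffOn_Icc (by linarith) 0 ⟨by linarith, by linarith⟩

lemma partialWithin_eq {a b : Fin p → ℝ} (hab : ∀ i, a i < b i) {n : ℕ}
    {f : (Fin p → ℝ) → ℝ}
    (hf : ContDiffOn ℝ ((n + 1 : ℕ) : WithTop ℕ∞) f (Set.Icc a b)) (i : Fin p) :
    Set.EqOn (partialWithin (Set.Icc a b) i f)
      (fun x => fderivWithin ℝ f (Set.Icc a b) x (Pi.single i 1)) (Set.Icc a b) := fun _ hx =>
  (hasLineDerivWithinAt_of_contDiffOn hf hx _).derivWithin (uniqueDiffWithinAt_line hab hx i)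

lemma uniqueDiffOn_box {a b : Fin p → ℝ} (hab : ∀ i, a i < b i) :
    UniqueDiffOn ℝ (Set.Icc a b) := by
  rw [← Set.pi_univ_Icc]
  exact UniqueDiffOn.univ_pi fun i => uniqueDiffOn_Icc (hab i)

/-- `T` behaves on the box `[a, b]` like a linear differential operator of order `m`. -/
def IsDiffOp (a b : Fin p → ℝ) (m : ℕ)
    (T : Set (Fin p → ℝ) → ((Fin p → ℝ) → ℝ) → ((Fin p → ℝ) → ℝ)) : Prop :=
  (∀ f g : (Fin p → ℝ) → ℝ, Set.EqOn f g (Set.Icc a b) →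
    Set.EqOn (T (Set.Icc a b) f) (T (Set.Icc a b) g) (Set.Icc a b)) ∧
  ∀ (n : ℕ) (f : (Fin p → ℝ) → ℝ),
    ContDiffOn ℝ ((n + m : ℕ) : WithTop ℕ∞) f (Set.Icc a b) →
    ContDiffOn ℝ (n : WithTop ℕ∞) (T (Set.Icc a b) f) (Set.Icc a b) ∧
    (∀ r : ℝ, Set.EqOn (T (Set.Icc a b) (r • f)) (r • T (Set.Icc a b) f) (Set.Icc a b)) ∧
    (∀ g : (Fin p → ℝ) → ℝ, ContDiffOn ℝ ((n + m : ℕ) : WithTop ℕ∞) g (Set.Icc a b) →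
      Set.EqOn (T (Set.Icc a b) (f + g)) (T (Set.Icc a b) f + T (Set.Icc a b) g)
        (Set.Icc a b)) ∧
    (∀ a' b' : Fin p → ℝ, (∀ i, a' i < b' i) → Set.Icc a' b' ⊆ Set.Icc a b →
      Set.EqOn (T (Set.Icc a' b') f) (T (Set.Icc a b) f) (Set.Icc a' b'))

lemma isDiffOp_id (a b : Fin p → ℝ) : IsDiffOp a b 0 (fun _ f => f) :=
  ⟨fun _ _ h => h, fun _ _ hf => ⟨hf, fun _ _ _ => rfl, fun _ _ _ _ => rfl,
    fun _ _ _ _ _ _ => rfl⟩⟩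

lemma isDiffOp_partialWithin {a b : Fin p → ℝ} (hab : ∀ i, a i < b i) (i : Fin p) :
    IsDiffOp a b 1 (fun s f => partialWithin s i f) := by
  refine ⟨fun f g h x hx => lineDerivWithin_congr' h hx, fun n f hf => ⟨?_, ?_, ?_, ?_⟩⟩
  · refine ContDiffOn.congr ?_ (partialWithin_eq hab hf i)
    exact (hf.fderivWithin (uniqueDiffOn_box hab) (by norm_cast)).clm_apply contDiffOn_const
  · intro r x hx
    exact ((hasLineDerivWithinAt_of_contDiffOn hf hx _).const_smul r).derivWithin
      (uniqueDiffWithinAt_line hab hx i) |>.trans (by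
        simp [partialWithin_eq hab hf i hx])
  · intro g hg x hx
    exact (HasDerivWithinAt.add (hasLineDerivWithinAt_of_contDiffOn hf hx _)
      (hasLineDerivWithinAt_of_contDiffOn hg hx _)).derivWithin
      (uniqueDiffWithinAt_line hab hx i) |>.trans (by
        simp [partialWithin_eq hab hf i hx, partialWithin_eq hab hg i hx])
  · intro a' b' hab' hss x hx
    refine (((hasLineDerivWithinAt_of_contDiffOn hf (hss hx) _).mono hss).derivWithin
      (uniqueDiffWithinAt_line hab' hx i)).trans ?_
    exact (partialWithin_eq hab hf i (hss hx)).symm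

lemma IsDiffOp.comp {a b : Fin p → ℝ} {m m' : ℕ}
    {T T' : Set (Fin p → ℝ) → ((Fin p → ℝ) → ℝ) → ((Fin p → ℝ) → ℝ)}
    (hc : ∀ a' b' : Fin p → ℝ, ∀ f g : (Fin p → ℝ) → ℝ, Set.EqOn f g (Set.Icc a' b') →
      Set.EqOn (T (Set.Icc a' b') f) (T (Set.Icc a' b') g) (Set.Icc a' b'))
    (hT : IsDiffOp a b m T) (hT' : IsDiffOp a b m' T') :
    IsDiffOp a b (m' + m) (fun s f => T s (T' s f)) := by
  refine ⟨fun f g h => hT.1 _ _ (hT'.1 _ _ h), fun n f hf => ?_⟩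
  have e : n + (m' + m) = (n + m) + m' := by omega
  rw [e] at hf
  obtain ⟨h1, h2, h3, h4⟩ := hT'.2 _ _ hf
  obtain ⟨k1, k2, k3, k4⟩ := hT.2 _ _ h1
  refine ⟨k1, fun r => (hT.1 _ _ (h2 r)).trans (k2 r), fun g hg => ?_, fun a' b' hab' hss => ?_⟩
  · rw [e] at hg
    exact (hT.1 _ _ (h3 g hg)).trans (k3 _ (hT'.2 _ _ hg).1)
  · exact (hc _ _ _ _ (h4 a' b' hab' hss)).trans (k4 a' b' hab' hss)

lemma partialWithin_iter_congr (s : Set (Fin p → ℝ)) (i : Fin p) (j : ℕ)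
    {f g : (Fin p → ℝ) → ℝ} (h : Set.EqOn f g s) :
    Set.EqOn ((partialWithin s i)^[j] f) ((partialWithin s i)^[j] g) s := by
  induction j generalizing f g with
  | zero => exact h
  | succ j ih => exact ih fun x hx => lineDerivWithin_congr' h hx

lemma isDiffOp_iter {a b : Fin p → ℝ} (hab : ∀ i, a i < b i) (i : Fin p) (j : ℕ) :
    IsDiffOp a b j (fun s f => (partialWithin s i)^[j] f) := by
  induction j with
  | zero => exact isDiffOp_id a b
  | succ j ih =>
    have h := IsDiffOp.comp (fun a' b' f g h => partialWithin_iter_congr _ i j h) ih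
      (isDiffOp_partialWithin hab i)
    rw [add_comm] at h
    exact h

lemma isDiffOp_mixedDeriv {a b : Fin p → ℝ} (hab : ∀ i, a i < b i) (α : Fin p → ℕ) :
    IsDiffOp a b (∑ i, α i) (fun s f => mixedDeriv s α f) := by
  have key : ∀ l : List (Fin p), IsDiffOp a b ((l.map α).sum)
      (fun s f => l.foldr (fun i g => (partialWithin s i)^[α i] g) f) := by
    intro l
    induction l with
    | nil => exact isDiffOp_id a b
    | cons i l ih =>
      have h := IsDiffOp.comp (fun a' b' f g h => partialWithin_iter_congr _ i (α i) h)
        (isDiffOp_iter hab i (α i)) ih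
      rw [add_comm] at h
      exact h
  have := key (List.finRange p)
  rwa [← List.ofFn_eq_map, List.sum_ofFn] at this

lemma zeroExt_add {s : Set (Fin p → ℝ)} (f g : s → ℝ) :
    zeroExt (f + g) = zeroExt f + zeroExt g := by
  funext x
  by_cases hx : ∃ y : s, (y : Fin p → ℝ) = x
  · obtain ⟨y, rfl⟩ := hx
    simp [zeroExt]
  · simp [zeroExt, Function.extend_apply' _ _ _ hx]

lemma zeroExt_smul {s : Set (Fin p → ℝ)} (r : ℝ) (f : s → ℝ) :
    zeroExt (r • f) = r • zeroExt f := by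
  funext x
  by_cases hx : ∃ y : s, (y : Fin p → ℝ) = x
  · obtain ⟨y, rfl⟩ := hx
    simp [zeroExt]
  · simp [zeroExt, Function.extend_apply' _ _ _ hx]

lemma sum_le_of_le {k : ℕ} {α : Fin p → ℕ} (hα : ∀ i, α i ≤ k) {N : ℕ∞}
    (hN : ((p * (k + 1) : ℕ) : ℕ∞) ≤ N) :
    ((0 + ∑ i, α i : ℕ) : WithTop ℕ∞) ≤ (N : WithTop ℕ∞) := by
  have h1 : ∑ i, α i ≤ p * (k + 1) := by
    calc ∑ i, α i ≤ ∑ _i : Fin p, (k + 1) :=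
          Finset.sum_le_sum fun i _ => (hα i).trans (Nat.le_succ k)
      _ = p * (k + 1) := by simp
  have h2 : ((0 + ∑ i, α i : ℕ) : ℕ∞) ≤ N :=
    le_trans (by rw [zero_add]; exact_mod_cast h1) hN
  exact_mod_cast h2

lemma Grid.cell_lt (G : Grid p) (c : (i : Fin p) → Fin (G.size i)) (i : Fin p) :
    G.node i (c i).castSucc < G.node i (c i).succ :=
  G.node_strictMono i (Fin.castSucc_lt_succ)

end aux

/-! ### The function space, the Hermite interpolant and the stability functional -/

variable {p : ℕ}

/-- The space of sufficiently smooth functions `Ω → ℝ`: those which are `C^N`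
(with `N ≥ p (k + 1)`) in each closed grid cell, and whose derivatives `∂^α` with
`α ∈ {0, …, k}ᵖ` have no jumps, that is, take the same value from any two cells at their common
points. It contains the functions that are `C^N` on `Ω` (see `mem_smoothSpace_of_contDiffOn`). -/
def smoothSpace (G : Grid p) (k : ℕ) (N : ℕ∞) (hN : ((p * (k + 1) : ℕ) : ℕ∞) ≤ N) :
    Submodule ℝ (G.domain → ℝ) where
  carrier := {φ | (∀ c, ContDiffOn ℝ N (zeroExt φ) (G.cell c)) ∧
    ∀ α : Fin p → ℕ, (∀ i, α i ≤ k) → ∀ c c', ∀ x ∈ G.cell c ∩ G.cell c',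
      mixedDeriv (G.cell c) α (zeroExt φ) x = mixedDeriv (G.cell c') α (zeroExt φ) x}
  add_mem' := by
    rintro f g ⟨hf, hf'⟩ ⟨hg, hg'⟩
    refine ⟨fun c => by rw [zeroExt_add]; exact (hf c).add (hg c), fun α hα c c' x hx => ?_⟩
    have key : ∀ c, ∀ x ∈ G.cell c, mixedDeriv (G.cell c) α (zeroExt f + zeroExt g) x =
        mixedDeriv (G.cell c) α (zeroExt f) x + mixedDeriv (G.cell c) α (zeroExt g) x :=
      fun c x hx => ((isDiffOp_mixedDeriv (G.cell_lt c) α).2 0 _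
        ((hf c).of_le (sum_le_of_le hα hN))).2.2.1 _ ((hg c).of_le (sum_le_of_le hα hN)) hx
    rw [zeroExt_add, key c x hx.1, key c' x hx.2, hf' α hα c c' x hx, hg' α hα c c' x hx]
  zero_mem' := by
    have h0 : zeroExt (0 : G.domain → ℝ) = 0 := by
      simpa using zeroExt_smul 0 (0 : G.domain → ℝ)
    have key : ∀ (s : Set (Fin p → ℝ)) (α : Fin p → ℕ), mixedDeriv s α 0 = 0 := by
      intro s α
      have h1 : ∀ i, partialWithin s i 0 = 0 := by
        intro i
        funext x
        simp [partialWithin, lineDerivWithin]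
      have h2 : ∀ i (j : ℕ), (partialWithin s i)^[j] 0 = 0 :=
        fun i j => Function.iterate_fixed (h1 i) j
      rw [mixedDeriv]
      induction List.finRange p with
      | nil => rfl
      | cons i l ih => rw [List.foldr_cons, ih, h2]
    refine ⟨fun c => by rw [h0]; exact contDiffOn_const, fun α _ c c' x _ => ?_⟩
    rw [h0, key, key]
  smul_mem' := by
    rintro r f ⟨hf, hf'⟩
    refine ⟨fun c => by rw [zeroExt_smul]; exact (hf c).const_smul r, fun α hα c c' x hx => ?_⟩
    have key : ∀ c, ∀ x ∈ G.cell c, mixedDeriv (G.cell c) α (r • zeroExt f) x =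
        r • mixedDeriv (G.cell c) α (zeroExt f) x :=
      fun c x hx => ((isDiffOp_mixedDeriv (G.cell_lt c) α).2 0 _
        ((hf c).of_le (sum_le_of_le hα hN))).2.1 r hx
    rw [zeroExt_smul, key c x hx.1, key c' x hx.2, hf' α hα c c' x hx]

lemma Grid.cell_subset_domain (G : Grid p) (c : (i : Fin p) → Fin (G.size i)) :
    G.cell c ⊆ G.domain :=
  Set.Icc_subset_Icc (fun i => (G.node_strictMono i).monotone (Fin.zero_le _))
    (fun i => (G.node_strictMono i).monotone (Fin.le_last _))

/-- Functions that are `C^N` on the whole of `Ω` belong to the space. -/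
lemma mem_smoothSpace_of_contDiffOn (G : Grid p) (k : ℕ) (N : ℕ∞)
    (hN : ((p * (k + 1) : ℕ) : ℕ∞) ≤ N) (φ : G.domain → ℝ)
    (hφ : ContDiffOn ℝ N (zeroExt φ) G.domain) : φ ∈ smoothSpace G k N hN := by
  refine ⟨fun c => hφ.mono (G.cell_subset_domain c), fun α hα c c' x hx => ?_⟩
  have hd : ∀ i, G.node i 0 < G.node i (Fin.last (G.size i)) := fun i =>
    G.node_strictMono i (Fin.mk_lt_mk.2 (G.size_pos i))
  have key : ∀ c, ∀ x ∈ G.cell c, mixedDeriv (G.cell c) α (zeroExt φ) x =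
      mixedDeriv G.domain α (zeroExt φ) x := fun c x hx =>
    ((isDiffOp_mixedDeriv hd α).2 0 _ (hφ.of_le (sum_le_of_le hα hN))).2.2.2 _ _
      (G.cell_lt c) (G.cell_subset_domain c) hx
  rw [key c x hx.1, key c' x hx.2]

/-- `H` is the global Hermite interpolant `H_φ`: on each closed grid cell it is given by a
polynomial of degree at most `n = 2 k + 1` in each variable, whose derivatives of order
`α ∈ {0, …, k}ᵖ` at the vertices of the cell equal the data `∂^α φ` there. -/
def IsHermiteInterpolant (G : Grid p) (k : ℕ) (φ H : G.domain → ℝ) : Prop :=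
  ∀ c : (i : Fin p) → Fin (G.size i), ∃ P : MvPolynomial (Fin p) ℝ,
    (∀ i, P.degreeOf i ≤ 2 * k + 1) ∧
    (∀ x : G.domain, (x : Fin p → ℝ) ∈ G.cell c → H x = MvPolynomial.eval (x : Fin p → ℝ) P) ∧
    ∀ (q : Fin p → Fin 2) (α : Fin p → ℕ), (∀ i, α i ≤ k) →
      mixedDeriv Set.univ α (fun x => MvPolynomial.eval x P) (G.vertex c q) =
        mixedDeriv G.domain α (zeroExt φ) (G.vertex c q)

/-- The derivative `∂^β φ` with `β = (k + 1, …, k + 1)`. For `φ` in the space above it exists in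
the interior of each grid cell, hence almost everywhere in `Ω`. -/
def topDeriv (G : Grid p) (k : ℕ) (φ : G.domain → ℝ) : (Fin p → ℝ) → ℝ :=
  mixedDeriv G.domain (fun _ => k + 1) (zeroExt φ)

/-- The stability functional `F[φ] = ∫_Ω (∂^β φ)²`. -/
def stabilityFunctional (G : Grid p) (k : ℕ) (φ : G.domain → ℝ) : ℝ :=
  ∫ x in G.domain, topDeriv G k φ x ^ 2

end HermiteProj

end

noncomputable section

namespace HermiteProj

/-! Orthogonality is a statement about one cell. There `H_f` is a sum of products of univariate
polynomials of degree at most `2k+1`, so `∂^β H_f` is a sum of products `∏ u_i(x_i)` with `u_i` of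
degree at most `k`. For `w = g - H_g`, all `∂^α w` with `α ≤ k` vanish at the vertices. Integrate `∏
u_i(x_i) ∂^β w` by parts `k+1` times in the first variable: `u_0` is differentiated away, and what
remains are integrals over the two faces `x_0 = const` of `∂_0^j w`, `j ≤ k`, differentiated `k+1`
times in each other variable. As partial derivatives commute, each is the same kind of integral in
one dimension less, for the restriction of `∂_0^j w` to the face, whose data vanish at the vertices
of the face. Induction on the dimension (`integral_prod_mul_mixedDeriv_eq_zero`) ends at a point,
where the integrand is itself a datum. Cells overlap in null sets, so summing over them gives `B(u,
v) = 0`.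

The interpolant is a tensor product construction. In one variable, `(X-l)^(k+1) (X-r)^(k+1)` has
degree `2k+2`, so a polynomial of degree at most `2k+1` is determined by its data. Products of
cardinal polynomials interpolate in each cell and fit together across faces (`hermiteBasis_eq`,
`mixedDeriv_cellInterpolant_eq`). Thus `P` is `interpolantMap` after `hermiteDataMap`, and
`hermiteData_interpolant` says that the composition in the other order is the identity; hence `P² =
P`, and the kernel of `P` consists of the functions without data.

Data and `∂^β` are defined by differentiating in the whole domain, whereas smoothness is known in
cells only. For `α ≤ k` the absence of jumps makes both derivatives agree (`opList_domain_eq`); for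
`∂^β` agreement in the open cells suffices, since the faces are null sets. -/

/-! ### Univariate Hermite interpolation -/

section univariate

open Polynomial

/-- A polynomial of degree at most `2 k + 1` is determined by its derivatives up to the order `k`
at two points. -/
lemma eq_zero_of_derivatives_eq_zero {k : ℕ} {l r : ℝ} (hlr : l ≠ r) {u : ℝ[X]}
    (hu : u.natDegree ≤ 2 * k + 1) (hl : ∀ j ≤ k, (derivative^[j] u).eval l = 0)
    (hr : ∀ j ≤ k, (derivative^[j] u).eval r = 0) : u = 0 := by
  by_contra h0
  have key : ∀ t : ℝ, (∀ j ≤ k, (derivative^[j] u).eval t = 0) → (X - C t) ^ (k + 1) ∣ u :=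
    fun t ht => (le_rootMultiplicity_iff h0).1
      ((lt_rootMultiplicity_iff_isRoot_iterate_derivative h0).2 fun m hm => ht m hm)
  -- Both coprime factors of degree `k+1` divide `u`, whose degree is less than `2k+2`.
  have hc : IsCoprime ((X - C l) ^ (k + 1)) ((X - C r) ^ (k + 1)) :=
    (isCoprime_X_sub_C_of_isUnit_sub (sub_ne_zero.2 hlr).isUnit).pow
  have h := natDegree_le_of_dvd (hc.mul_dvd (key l hl) (key r hr)) h0
  rw [natDegree_mul (pow_ne_zero _ (X_sub_C_ne_zero l)) (pow_ne_zero _ (X_sub_C_ne_zero r)),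
    natDegree_pow, natDegree_pow, natDegree_X_sub_C, natDegree_X_sub_C] at h
  omega

/-- Univariate Hermite interpolation at two points. -/
lemma exists_hermite (k : ℕ) {l r : ℝ} (hlr : l ≠ r) (d : Fin 2 → Fin (k + 1) → ℝ) :
    ∃ u : ℝ[X], u.natDegree ≤ 2 * k + 1 ∧
      ∀ j : Fin (k + 1), (derivative^[j] u).eval l = d 0 j ∧ (derivative^[j] u).eval r = d 1 j := by
  let L : ℝ[X] →ₗ[ℝ] (Fin 2 × Fin (k + 1) → ℝ) := LinearMap.pi fun x =>
    (leval (if x.1 = 0 then l else r)).comp (derivative ^ (x.2 : ℕ))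
  have hL : ∀ u x, L u x = (derivative^[x.2] u).eval (if x.1 = 0 then l else r) := fun u x => by
    simp [L, Module.End.pow_apply, leval]
  have hdeg : ∀ u : ℝ[X], u ∈ degreeLT ℝ (2 * k + 2) → u.natDegree ≤ 2 * k + 1 := fun u hu => by
    rw [mem_degreeLT] at hu
    by_cases h0 : u = 0
    · simp [h0]
    · have := (natDegree_lt_iff_degree_lt h0).2 hu
      omega
  let L' := L.comp (degreeLT ℝ (2 * k + 2)).subtype
  have hinj : Function.Injective L' := by
    rw [← LinearMap.ker_eq_bot, LinearMap.ker_eq_bot']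
    rintro ⟨u, hu⟩ h
    have h' : ∀ x, L u x = 0 := fun x => congrFun h x
    refine Subtype.ext (eq_zero_of_derivatives_eq_zero hlr (hdeg u hu) (fun j hj => ?_)
      fun j hj => ?_)
    · simpa [hL] using h' (0, ⟨j, by omega⟩)
    · simpa [hL] using h' (1, ⟨j, by omega⟩)
  have : FiniteDimensional ℝ (degreeLT ℝ (2 * k + 2)) :=
    Module.Finite.equiv (degreeLTEquiv ℝ (2 * k + 2)).symm
  -- There are `2k+2` coefficients and `2k+2` data, so uniqueness implies existence.
  have hrank : Module.finrank ℝ (degreeLT ℝ (2 * k + 2)) =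
      Module.finrank ℝ (Fin 2 × Fin (k + 1) → ℝ) := by
    rw [(degreeLTEquiv ℝ (2 * k + 2)).finrank_eq]
    simp
    ring
  obtain ⟨⟨u, hu⟩, h⟩ := (LinearMap.injective_iff_surjective_of_finrank_eq_finrank hrank).1 hinj
    fun x => d x.1 x.2
  have h' : ∀ x, L u x = d x.1 x.2 := fun x => congrFun h x
  refine ⟨u, hdeg u hu, fun j => ⟨?_, ?_⟩⟩
  · simpa [hL] using h' (0, j)
  · simpa [hL] using h' (1, j)

variable (k : ℕ) {M : ℕ} (x : Fin (M + 1) → ℝ)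

/-- The defining properties of the Hermite basis polynomial of the interval `[x_c, x_{c+1}]` that
belongs to the node `x_n` and the derivative of order `γ`. It vanishes if `x_n` is not an endpoint
of the interval. -/
def IsHermiteBasis (c : Fin M) (m : Fin (M + 1) × Fin (k + 1)) (u : ℝ[X]) : Prop :=
  u.natDegree ≤ 2 * k + 1 ∧ (m.1 ≠ c.castSucc → m.1 ≠ c.succ → u = 0) ∧
  ∀ n, n = c.castSucc ∨ n = c.succ → ∀ j : Fin (k + 1),
    (derivative^[j] u).eval (x n) = if m = (n, j) then 1 else 0

variable {x}

/-- For an endpoint, this is interpolation of Kronecker delta data. A node that is not an endpoint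
contributes no data to the interval, and the zero polynomial works. -/
lemma exists_isHermiteBasis (hx : StrictMono x) (c : Fin M) (m : Fin (M + 1) × Fin (k + 1)) :
    ∃ u, IsHermiteBasis k x c m u := by
  by_cases hm : m.1 ≠ c.castSucc ∧ m.1 ≠ c.succ
  · refine ⟨0, by simp, fun _ _ => rfl, fun n hn j => ?_⟩
    rw [if_neg, iterate_derivative_zero, eval_zero]
    rintro rfl
    rcases hn with h | h
    · exact hm.1 h
    · exact hm.2 h
  · have hne : x c.castSucc ≠ x c.succ := (hx Fin.castSucc_lt_succ).ne
    obtain ⟨u, hu, h⟩ := exists_hermite k hne fun q j =>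
      if m = (if q = 0 then c.castSucc else c.succ, j) then 1 else 0
    refine ⟨u, hu, fun h1 h2 => (hm ⟨h1, h2⟩).elim, ?_⟩
    rintro n (rfl | rfl) j
    · simpa using (h j).1
    · simpa using (h j).2

variable (x) in
open Classical in
/-- The Hermite basis polynomials (zero if the nodes are not increasing). -/
def hermiteBasis (c : Fin M) (m : Fin (M + 1) × Fin (k + 1)) : ℝ[X] :=
  if h : ∃ u, IsHermiteBasis k x c m u then h.choose else 0

lemma isHermiteBasis (hx : StrictMono x) (c : Fin M) (m : Fin (M + 1) × Fin (k + 1)) :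
    IsHermiteBasis k x c m (hermiteBasis k x c m) := by
  have h := exists_isHermiteBasis k hx c m
  rw [hermiteBasis, dif_pos h]
  exact h.choose_spec

variable {k}

/-- Expansion of a polynomial in the Hermite basis. -/
lemma sum_hermiteBasis (hx : StrictMono x) (c : Fin M) {u : ℝ[X]}
    (hu : u.natDegree ≤ 2 * k + 1) :
    u = ∑ m : Fin (M + 1) × Fin (k + 1),
      C ((derivative^[m.2] u).eval (x m.1)) * hermiteBasis k x c m := by
  have hb := isHermiteBasis k hx c
  rw [← sub_eq_zero]
  have key : ∀ n, n = c.castSucc ∨ n = c.succ → ∀ j ≤ k, (derivative^[j] (u - ∑ m :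
      Fin (M + 1) × Fin (k + 1), C ((derivative^[m.2] u).eval (x m.1)) *
        hermiteBasis k x c m)).eval (x n) = 0 := by
    intro n hn j hj
    rw [iterate_derivative_sub, iterate_derivative_sum, eval_sub, eval_finsetSum,
      Finset.sum_eq_single (n, (⟨j, by omega⟩ : Fin (k + 1)))]
    · rw [iterate_derivative_C_mul, eval_mul, (hb _).2.2 n hn ⟨j, by omega⟩]
      simp
    · intro m _ hm
      rw [iterate_derivative_C_mul, eval_mul, (hb _).2.2 n hn ⟨j, by omega⟩, if_neg hm, mul_zero]
    · simp
  refine eq_zero_of_derivatives_eq_zero (hx (Fin.castSucc_lt_succ (i := c))).ne ?_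
    (key _ (Or.inl rfl)) (key _ (Or.inr rfl))
  refine (natDegree_sub_le _ _).trans (max_le hu (natDegree_sum_le_of_forall_le _ _ fun m _ => ?_))
  exact (natDegree_C_mul_le _ _).trans (hb m).1

/-- The derivatives up to the order `k` of the Hermite basis have no jumps. -/
lemma hermiteBasis_eq (hx : StrictMono x) {c c' : Fin M} {t : ℝ}
    (ht : t ∈ Set.Icc (x c.castSucc) (x c.succ)) (ht' : t ∈ Set.Icc (x c'.castSucc) (x c'.succ))
    (m : Fin (M + 1) × Fin (k + 1)) {j : ℕ} (hj : j ≤ k) :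
    (derivative^[j] (hermiteBasis k x c m)).eval t =
      (derivative^[j] (hermiteBasis k x c' m)).eval t := by
  have key : ∀ c c' : Fin M, c < c' → t ∈ Set.Icc (x c.castSucc) (x c.succ) →
      t ∈ Set.Icc (x c'.castSucc) (x c'.succ) →
      (derivative^[j] (hermiteBasis k x c m)).eval t =
        (derivative^[j] (hermiteBasis k x c' m)).eval t := by
    intro c c' h ht ht'
    have h1 : c.succ ≤ c'.castSucc := by
      rw [Fin.le_def, Fin.val_succ, Fin.val_castSucc]
      exact h
    -- Two distinct intervals share `t` only if they are adjacent and `t` is their common node,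
    -- where both polynomials have the same Kronecker data.
    have h2 : x c.succ = x c'.castSucc :=
      le_antisymm (hx.monotone h1) (ht'.1.trans ht.2)
    have h3 : t = x c.succ := le_antisymm ht.2 (h2 ▸ ht'.1)
    rw [h3, (isHermiteBasis k hx c m).2.2 _ (Or.inr rfl) ⟨j, by omega⟩,
      (isHermiteBasis k hx c' m).2.2 _ (Or.inl (hx.injective h2)) ⟨j, by omega⟩]
  rcases lt_trichotomy c c' with h | rfl | h
  · exact key c c' h ht ht'
  · rfl
  · exact (key c' c h ht' ht).symm

/-- Repeated integration by parts against a polynomial. -/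
lemma exists_integral_by_parts {k : ℕ} {l r : ℝ} (hlr : l ≤ r) {u : ℝ[X]} (hu : u.natDegree ≤ k) :
    ∃ cl cr : ℕ → ℝ, ∀ F : ℕ → ℝ → ℝ,
      (∀ j ≤ k, ∀ t ∈ Set.Icc l r, HasDerivWithinAt (F j) (F (j + 1) t) (Set.Icc l r) t) →
      ContinuousOn (F (k + 1)) (Set.Icc l r) →
      ∫ t in Set.Icc l r, u.eval t * F (k + 1) t =
        ∑ j ∈ Finset.range (k + 1), (cl j * F j l + cr j * F j r) := by
  have parts : ∀ (v : ℝ[X]) (f f' : ℝ → ℝ),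
      (∀ t ∈ Set.Icc l r, HasDerivWithinAt f (f' t) (Set.Icc l r) t) →
      ContinuousOn f' (Set.Icc l r) →
      ∫ t in Set.Icc l r, v.eval t * f' t = v.eval r * f r - v.eval l * f l -
        ∫ t in Set.Icc l r, (derivative v).eval t * f t := by
    intro v f f' hf hf'
    have := intervalIntegral.integral_mul_deriv_eq_deriv_mul_of_hasDerivWithinAt (a := l) (b := r)
      (u := fun t => v.eval t) (u' := fun t => (derivative v).eval t) (v := f) (v' := f')
      (fun t _ => (v.hasDerivAt t).hasDerivWithinAt)
      (fun t ht => by rw [Set.uIcc_of_le hlr] at *; exact hf t ht)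
      ((derivative v).continuous.intervalIntegrable _ _)
      (ContinuousOn.intervalIntegrable (by rwa [Set.uIcc_of_le hlr]))
    rwa [intervalIntegral.integral_of_le hlr, intervalIntegral.integral_of_le hlr,
      ← integral_Icc_eq_integral_Ioc, ← integral_Icc_eq_integral_Ioc] at this
  -- Each integration by parts lowers the degree of `u` and the order of the derivative of `F` by
  -- one; a constant `u` leaves boundary terms only.
  induction k generalizing u with
  | zero =>
    refine ⟨fun _ => -u.eval l, fun _ => u.eval r, fun F hF hc => ?_⟩
    rw [parts u (F 0) _ (hF 0 le_rfl) hc, derivative_of_natDegree_zero (by omega)]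
    simp
    ring
  | succ k ih =>
    obtain ⟨cl, cr, h⟩ := ih (u := derivative u) (by
      have := natDegree_derivative_le u
      omega)
    -- The term `j = k+1` is the new boundary term; the earlier ones change sign because the
    -- remaining integral is subtracted.
    refine ⟨fun j => if j = k + 1 then -u.eval l else - cl j,
      fun j => if j = k + 1 then u.eval r else - cr j, fun F hF hc => ?_⟩
    have e : ∀ j ∈ Finset.range (k + 1), (if j = k + 1 then -u.eval l else - cl j) * F j l +
        (if j = k + 1 then u.eval r else - cr j) * F j r = -(cl j * F j l + cr j * F j r) := by
      intro j hj
      rw [if_neg (Finset.mem_range.1 hj).ne, if_neg (Finset.mem_range.1 hj).ne]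
      ring
    rw [parts u (F (k + 1)) _ (hF (k + 1) le_rfl) hc, h F (fun j hj => hF j (by omega))
      fun t ht => (hF (k + 1) le_rfl t ht).continuousWithinAt, Finset.sum_range_succ _ (k + 1),
      Finset.sum_congr rfl e, Finset.sum_neg_distrib]
    simp only [if_true]
    ring

end univariate

/-! ### Compositions of partial derivatives -/

section opList

variable {p : ℕ}

/-- The composition of the partial derivatives `∂ᵢ^{αᵢ}` for `i` in the list `l`. -/
def opList (s : Set (Fin p → ℝ)) (l : List (Fin p)) (α : Fin p → ℕ) (f : (Fin p → ℝ) → ℝ) :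
    (Fin p → ℝ) → ℝ :=
  l.foldr (fun i g => (partialWithin s i)^[α i] g) f

lemma mixedDeriv_eq_opList (s : Set (Fin p → ℝ)) (α : Fin p → ℕ) (f : (Fin p → ℝ) → ℝ) :
    mixedDeriv s α f = opList s (List.finRange p) α f := rfl

lemma opList_cons (s : Set (Fin p → ℝ)) (i : Fin p) (l : List (Fin p)) (α : Fin p → ℕ)
    (f : (Fin p → ℝ) → ℝ) :
    opList s (i :: l) α f = (partialWithin s i)^[α i] (opList s l α f) := rfl

lemma opList_congr (s : Set (Fin p → ℝ)) (l : List (Fin p)) (α : Fin p → ℕ)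
    {f g : (Fin p → ℝ) → ℝ} (h : Set.EqOn f g s) : Set.EqOn (opList s l α f) (opList s l α g) s := by
  induction l with
  | nil => exact h
  | cons i l ih => exact partialWithin_iter_congr s i (α i) ih

lemma opList_congr_index (s : Set (Fin p → ℝ)) {l : List (Fin p)} {α α' : Fin p → ℕ}
    (h : ∀ i ∈ l, α i = α' i) (f : (Fin p → ℝ) → ℝ) : opList s l α f = opList s l α' f := by
  induction l with
  | nil => rfl
  | cons i l ih =>
    rw [opList_cons, opList_cons, ih fun j hj => h j (List.mem_cons_of_mem _ hj),
      h i List.mem_cons_self]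

lemma opList_append (s : Set (Fin p → ℝ)) (l l' : List (Fin p)) (α : Fin p → ℕ)
    (f : (Fin p → ℝ) → ℝ) : opList s (l ++ l') α f = opList s l α (opList s l' α f) :=
  List.foldr_append

lemma opList_eq_self (s : Set (Fin p → ℝ)) {l : List (Fin p)} {α : Fin p → ℕ}
    (h : ∀ i ∈ l, α i = 0) (f : (Fin p → ℝ) → ℝ) : opList s l α f = f := by
  induction l with
  | nil => rfl
  | cons i l ih =>
    rw [opList_cons, ih fun j hj => h j (List.mem_cons_of_mem _ hj), h i List.mem_cons_self]
    rfl

lemma isDiffOp_opList {a b : Fin p → ℝ} (hab : ∀ i, a i < b i) (l : List (Fin p))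
    (α : Fin p → ℕ) : IsDiffOp a b (l.map α).sum (fun s f => opList s l α f) := by
  induction l with
  | nil => exact isDiffOp_id a b
  | cons i l ih =>
    have h := IsDiffOp.comp (fun a' b' f g h => partialWithin_iter_congr _ i (α i) h)
      (isDiffOp_iter hab i (α i)) ih
    rw [add_comm] at h
    exact h

lemma contDiffOn_iter_partialWithin {a b : Fin p → ℝ} (hab : ∀ i, a i < b i) (i : Fin p)
    {m n : ℕ} {f : (Fin p → ℝ) → ℝ} (hf : ContDiffOn ℝ ((n + m : ℕ) : WithTop ℕ∞) f (Set.Icc a b)) :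
    ContDiffOn ℝ (n : WithTop ℕ∞) ((partialWithin (Set.Icc a b) i)^[m] f) (Set.Icc a b) :=
  ((isDiffOp_iter hab i m).2 n f hf).1

lemma contDiffOn_opList {a b : Fin p → ℝ} (hab : ∀ i, a i < b i) {l : List (Fin p)}
    {α : Fin p → ℕ} {n : ℕ} {f : (Fin p → ℝ) → ℝ}
    (hf : ContDiffOn ℝ ((n + (l.map α).sum : ℕ) : WithTop ℕ∞) f (Set.Icc a b)) :
    ContDiffOn ℝ (n : WithTop ℕ∞) (opList (Set.Icc a b) l α f) (Set.Icc a b) :=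
  ((isDiffOp_opList hab l α).2 n f hf).1

/-- Partial derivatives at interior points do not depend on the set. -/
lemma partialWithin_eq_of_isOpen {s t U : Set (Fin p → ℝ)} (hU : IsOpen U) (hs : U ⊆ s)
    (ht : U ⊆ t) (i : Fin p) {f g : (Fin p → ℝ) → ℝ} (h : Set.EqOn f g U) :
    Set.EqOn (partialWithin s i f) (partialWithin t i g) U := by
  intro x hx
  have hn := hU.mem_nhds hx
  rw [partialWithin, partialWithin, lineDerivWithin_of_mem_nhds (Filter.mem_of_superset hn hs),
    lineDerivWithin_of_mem_nhds (Filter.mem_of_superset hn ht)]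
  exact Filter.EventuallyEq.lineDeriv_eq (Filter.eventuallyEq_of_mem hn h)

lemma opList_eq_of_isOpen {s t U : Set (Fin p → ℝ)} (hU : IsOpen U) (hs : U ⊆ s)
    (ht : U ⊆ t) (l : List (Fin p)) (α : Fin p → ℕ) {f g : (Fin p → ℝ) → ℝ}
    (h : Set.EqOn f g U) : Set.EqOn (opList s l α f) (opList t l α g) U := by
  induction l with
  | nil => exact h
  | cons i l ih =>
    rw [opList_cons, opList_cons]
    induction α i with
    | zero => exact ih
    | succ n ihn =>
      rw [Function.iterate_succ_apply', Function.iterate_succ_apply']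
      exact partialWithin_eq_of_isOpen hU hs ht i ihn

end opList

/-! ### Sums of products of univariate polynomials -/

section tensor

open Polynomial

variable {p : ℕ} {ι : Type*}

/-- The function `x ↦ ∑ₘ wₘ ∏ᵢ uₘᵢ(xᵢ)`. -/
def tensorSum (S : Finset ι) (w : ι → ℝ) (u : ι → Fin p → ℝ[X]) (x : Fin p → ℝ) : ℝ :=
  ∑ m ∈ S, w m * ∏ i, (u m i).eval (x i)

/-- The set `s` determines the partial derivatives at its points. -/
def UniqueLineDiffOn (s : Set (Fin p → ℝ)) : Prop :=
  ∀ x ∈ s, ∀ i, UniqueDiffWithinAt ℝ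
    ((fun t : ℝ => x + t • (Pi.single i 1 : Fin p → ℝ)) ⁻¹' s) 0

lemma uniqueLineDiffOn_Icc {a b : Fin p → ℝ} (hab : ∀ i, a i < b i) :
    UniqueLineDiffOn (Set.Icc a b) := fun _ hx i => uniqueDiffWithinAt_line hab hx i

lemma uniqueLineDiffOn_univ : UniqueLineDiffOn (Set.univ : Set (Fin p → ℝ)) := fun _ _ _ => by
  rw [Set.preimage_univ]
  exact uniqueDiffWithinAt_univ

variable {s : Set (Fin p → ℝ)} (hs : UniqueLineDiffOn s) (S : Finset ι) (w : ι → ℝ)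
  (u : ι → Fin p → ℝ[X])

include hs in
lemma partialWithin_tensorSum (i : Fin p) : Set.EqOn (partialWithin s i (tensorSum S w u))
    (tensorSum S w fun m => Function.update (u m) i (derivative (u m i))) s := by
  intro x hx
  have h1 : ∀ m, HasDerivAt
      (fun t : ℝ => ∏ j, (u m j).eval ((x + t • (Pi.single i 1 : Fin p → ℝ)) j))
      (∏ j, (Function.update (u m) i (derivative (u m i)) j).eval (x j)) 0 := by
    intro m
    -- Along a line in direction `i` only the `i`-th factor varies.
    have e : (fun t : ℝ => ∏ j, (u m j).eval ((x + t • (Pi.single i 1 : Fin p → ℝ)) j)) =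
        fun t => (u m i).eval (x i + t) * ∏ j ∈ Finset.univ.erase i, (u m j).eval (x j) := by
      funext t
      rw [← Finset.mul_prod_erase _ _ (Finset.mem_univ i)]
      congr 1
      · simp
      · refine Finset.prod_congr rfl fun j hj => ?_
        simp [Pi.single_eq_of_ne (Finset.ne_of_mem_erase hj)]
    have e' : ∏ j, (Function.update (u m) i (derivative (u m i)) j).eval (x j) =
        (derivative (u m i)).eval (x i) * ∏ j ∈ Finset.univ.erase i, (u m j).eval (x j) := by
      rw [← Finset.mul_prod_erase _ _ (Finset.mem_univ i), Function.update_self]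
      refine congrArg _ (Finset.prod_congr rfl fun j hj => ?_)
      rw [Function.update_of_ne (Finset.ne_of_mem_erase hj)]
    rw [e, e']
    refine HasDerivAt.mul_const ?_ _
    have := HasDerivAt.comp_const_add (x i) 0 ((u m i).hasDerivAt (x i + 0))
    simpa using this
  have h2 := HasDerivAt.fun_sum (u := S) fun m _ => (h1 m).const_mul (w m)
  exact h2.hasDerivWithinAt.derivWithin (hs x hx i)

include hs in
lemma iter_partialWithin_tensorSum (i : Fin p) (n : ℕ) :
    Set.EqOn ((partialWithin s i)^[n] (tensorSum S w u))
      (tensorSum S w fun m => Function.update (u m) i (derivative^[n] (u m i))) s := by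
  induction n generalizing u with
  | zero => intro x _; simp
  | succ n ih =>
    refine (partialWithin_iter_congr s i n (partialWithin_tensorSum hs S w u i)).trans
      ((ih _).trans ?_)
    intro x _
    simp

include hs in
lemma opList_tensorSum {l : List (Fin p)} (hl : l.Nodup) (α : Fin p → ℕ) :
    Set.EqOn (opList s l α (tensorSum S w u))
      (tensorSum S w fun m j => if j ∈ l then derivative^[α j] (u m j) else u m j) s := by
  induction l with
  | nil => intro x _; simp [opList]
  | cons i l ih =>
    rw [List.nodup_cons] at hl
    refine (partialWithin_iter_congr s i (α i) (ih hl.2)).trans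
      ((iter_partialWithin_tensorSum hs S w _ i (α i)).trans ?_)
    intro x _
    congr 1
    funext m j
    by_cases hj : j = i
    · subst hj
      -- As `j ∉ l`, the `j`-th factor has not been differentiated by the inner operators.
      simp [hl.1]
    · simp [hj]

include hs in
lemma mixedDeriv_tensorSum (α : Fin p → ℕ) : Set.EqOn (mixedDeriv s α (tensorSum S w u))
    (tensorSum S w fun m j => derivative^[α j] (u m j)) s := by
  simpa [mixedDeriv_eq_opList] using opList_tensorSum hs S w u (List.nodup_finRange p) α

lemma contDiff_tensorSum {n : WithTop ℕ∞} : ContDiff ℝ n (tensorSum S w u) := by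
  refine ContDiff.sum fun m _ => contDiff_const.mul (contDiff_prod fun i _ => ?_)
  have h : ContDiff ℝ n fun t => (u m i).eval t := by
    simpa using (u m i).contDiff_aeval (R := ℝ) (𝕜 := ℝ) n
  exact h.comp (contDiff_apply ℝ ℝ i)

/-- A polynomial as a sum of products of powers. -/
lemma eval_eq_tensorSum (P : MvPolynomial (Fin p) ℝ) :
    (fun x => MvPolynomial.eval x P) =
      tensorSum P.support (fun m => P.coeff m) fun m i => X ^ m i := by
  funext x
  simp [tensorSum, MvPolynomial.eval_eq']

/-- A sum of products of univariate polynomials as a polynomial. -/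
lemma exists_mvPolynomial_of_tensorSum {n : ℕ} (hu : ∀ m i, (u m i).natDegree ≤ n) :
    ∃ P : MvPolynomial (Fin p) ℝ, (∀ i, P.degreeOf i ≤ n) ∧
      ∀ x, MvPolynomial.eval x P = tensorSum S w u x := by
  refine ⟨∑ m ∈ S, MvPolynomial.C (w m) * ∏ i, aeval (MvPolynomial.X i) (u m i), fun i => ?_,
    fun x => ?_⟩
  · refine (MvPolynomial.degreeOf_sum_le i _ _).trans (Finset.sup_le fun m _ => ?_)
    refine (MvPolynomial.degreeOf_mul_le i _ _).trans ?_
    rw [MvPolynomial.degreeOf_C, zero_add]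
    refine (MvPolynomial.degreeOf_prod_le i _ _).trans ?_
    -- Only the factor with `j = i` involves the variable `i`, so the sum of the degrees over `j`
    -- collapses to `n`.
    have h : ∀ j, MvPolynomial.degreeOf i (aeval (MvPolynomial.X j : MvPolynomial (Fin p) ℝ)
        (u m j)) ≤ if j = i then n else 0 := by
      intro j
      rw [aeval_eq_sum_range]
      refine (MvPolynomial.degreeOf_sum_le i _ _).trans (Finset.sup_le fun d hd => ?_)
      rw [MvPolynomial.smul_eq_C_mul]
      refine (MvPolynomial.degreeOf_mul_le i _ _).trans ?_
      rw [MvPolynomial.degreeOf_C, zero_add]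
      refine (MvPolynomial.degreeOf_pow_le i _ _).trans ?_
      rw [MvPolynomial.degreeOf_X]
      have := hu m j
      rw [Finset.mem_range] at hd
      split_ifs with h1 h2 h2
      · omega
      · exact absurd h1.symm h2
      · exact absurd h2.symm h1
      · simp
    exact (Finset.sum_le_sum fun j _ => h j).trans (by simp)
  · have h : ∀ (q : ℝ[X]) (i : Fin p), MvPolynomial.eval x (aeval (MvPolynomial.X i) q) =
        q.eval (x i) := by
      intro q i
      rw [← MvPolynomial.coe_aeval_eq_eval, RingHom.coe_coe, ← Polynomial.aeval_algHom_apply]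
      simp [Polynomial.aeval_def, Polynomial.eval₂_eq_eval_map]
    simp [tensorSum, map_sum, map_prod, h]

end tensor

/-! ### Partial derivatives in boxes commute -/

section comm

variable {p : ℕ} {a b : Fin p → ℝ} (hab : ∀ i, a i < b i)

include hab

/-- The second derivative is symmetric up to the boundary: the box is convex with nonempty interior,
so each of its points is a limit of interior points. -/
lemma partialWithin_comm (i j : Fin p) {f : (Fin p → ℝ) → ℝ}
    (hf : ContDiffOn ℝ ((1 + 1 : ℕ) : WithTop ℕ∞) f (Set.Icc a b)) :
    Set.EqOn (partialWithin (Set.Icc a b) i (partialWithin (Set.Icc a b) j f))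
      (partialWithin (Set.Icc a b) j (partialWithin (Set.Icc a b) i f)) (Set.Icc a b) := by
  have hu := uniqueDiffOn_box hab
  have hf' : ContDiffOn ℝ ((0 + 1 : ℕ) : WithTop ℕ∞) (fderivWithin ℝ f (Set.Icc a b))
      (Set.Icc a b) := hf.fderivWithin hu (by norm_cast)
  have key : ∀ i j, Set.EqOn (partialWithin (Set.Icc a b) i (partialWithin (Set.Icc a b) j f))
      (fun x => fderivWithin ℝ (fderivWithin ℝ f (Set.Icc a b)) (Set.Icc a b) x
        (Pi.single i 1) (Pi.single j 1)) (Set.Icc a b) := by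
    intro i j x hx
    have h1 := partialWithin_iter_congr (Set.Icc a b) i 1 (partialWithin_eq hab hf j) hx
    have h2 := partialWithin_eq hab (hf'.clm_apply
      (contDiffOn_const (c := (Pi.single j 1 : Fin p → ℝ)))) i hx
    refine (h1.trans h2).trans ?_
    have h3 := ((hf'.differentiableOn (by simp) x hx).hasFDerivWithinAt).clm_apply
      (hasFDerivWithinAt_const (Pi.single j 1 : Fin p → ℝ) x (Set.Icc a b))
    exact (congrArg (fun L : (Fin p → ℝ) →L[ℝ] ℝ => L (Pi.single i 1))
      (h3.fderivWithin (hu x hx))).trans (by simp)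
  intro x hx
  have hcl : x ∈ closure (interior (Set.Icc a b)) := by
    have hne : (interior (Set.Icc a b)).Nonempty := by
      rw [← Set.pi_univ_Icc, interior_pi_set Set.finite_univ, Set.univ_pi_nonempty_iff]
      intro i
      rw [interior_Icc]
      exact Set.nonempty_Ioo.2 (hab i)
    rw [(convex_Icc (𝕜 := ℝ) a b).closure_interior_eq_closure_of_nonempty_interior hne]
    exact subset_closure hx
  have hsym : IsSymmSndFDerivWithinAt ℝ f (Set.Icc a b) x :=
    (hf x hx).isSymmSndFDerivWithinAt (by simp) hu hcl hx
  rw [key i j hx, key j i hx]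
  exact hsym _ _

lemma partialWithin_iter_comm (i j : Fin p) (m : ℕ) {f : (Fin p → ℝ) → ℝ}
    (hf : ContDiffOn ℝ ((m + 1 : ℕ) : WithTop ℕ∞) f (Set.Icc a b)) :
    Set.EqOn (partialWithin (Set.Icc a b) i ((partialWithin (Set.Icc a b) j)^[m] f))
      ((partialWithin (Set.Icc a b) j)^[m] (partialWithin (Set.Icc a b) i f)) (Set.Icc a b) := by
  induction m generalizing f with
  | zero => exact fun _ _ => rfl
  | succ m ih =>
    refine (ih (contDiffOn_iter_partialWithin hab j (m := 1) hf)).trans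
      (partialWithin_iter_congr _ j m (partialWithin_comm hab i j (hf.of_le ?_)))
    exact_mod_cast (by omega : 1 + 1 ≤ m + 1 + 1)

lemma partialWithin_opList_comm (i : Fin p) (l : List (Fin p)) (α : Fin p → ℕ)
    {f : (Fin p → ℝ) → ℝ}
    (hf : ContDiffOn ℝ ((1 + (l.map α).sum : ℕ) : WithTop ℕ∞) f (Set.Icc a b)) :
    Set.EqOn (partialWithin (Set.Icc a b) i (opList (Set.Icc a b) l α f))
      (opList (Set.Icc a b) l α (partialWithin (Set.Icc a b) i f)) (Set.Icc a b) := by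
  induction l with
  | nil => exact fun _ _ => rfl
  | cons j l ih =>
    rw [List.map_cons, List.sum_cons] at hf
    refine (partialWithin_iter_comm hab i j (α j) (contDiffOn_opList hab
      (by convert hf using 2; omega))).trans
      (partialWithin_iter_congr _ j (α j) (ih (hf.of_le ?_)))
    exact_mod_cast (by omega : 1 + (l.map α).sum ≤ 1 + (α j + (l.map α).sum))

lemma iter_partialWithin_opList_comm (i : Fin p) (m : ℕ) (l : List (Fin p)) (α : Fin p → ℕ)
    {f : (Fin p → ℝ) → ℝ}
    (hf : ContDiffOn ℝ ((m + (l.map α).sum : ℕ) : WithTop ℕ∞) f (Set.Icc a b)) :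
    Set.EqOn ((partialWithin (Set.Icc a b) i)^[m] (opList (Set.Icc a b) l α f))
      (opList (Set.Icc a b) l α ((partialWithin (Set.Icc a b) i)^[m] f)) (Set.Icc a b) := by
  induction m generalizing f with
  | zero => exact fun _ _ => rfl
  | succ m ih =>
    refine (partialWithin_iter_congr _ i m (partialWithin_opList_comm hab i l α
      (hf.of_le ?_))).trans (ih (contDiffOn_iter_partialWithin hab i (m := 1) ?_))
    · exact_mod_cast (by omega : 1 + (l.map α).sum ≤ m + 1 + (l.map α).sum)
    · convert hf using 2
      omega

end comm

/-! ### Splitting off the first variable -/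

section slice

variable {p : ℕ} {a b : Fin (p + 1) → ℝ}

lemma cons_mem_Icc {t : ℝ} {y : Fin p → ℝ} :
    (Fin.cons t y : Fin (p + 1) → ℝ) ∈ Set.Icc a b ↔
      t ∈ Set.Icc (a 0) (b 0) ∧ y ∈ Set.Icc (Fin.tail a) (Fin.tail b) := by
  simp only [Set.mem_Icc, Pi.le_def, Fin.forall_fin_succ, Fin.cons_zero, Fin.cons_succ, Fin.tail]
  tauto

lemma contDiff_cons (n : WithTop ℕ∞) (t : ℝ) :
    ContDiff ℝ n (fun y : Fin p → ℝ => (Fin.cons t y : Fin (p + 1) → ℝ)) := by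
  refine contDiff_pi.2 fun i => Fin.cases ?_ (fun j => ?_) i
  · simpa using contDiff_const
  · simpa using contDiff_apply ℝ ℝ j

lemma partialWithin_succ_cons {t : ℝ} (ht : t ∈ Set.Icc (a 0) (b 0)) (i : Fin p)
    (f : (Fin (p + 1) → ℝ) → ℝ) :
    (fun y : Fin p → ℝ => partialWithin (Set.Icc a b) i.succ f (Fin.cons t y)) =
      partialWithin (Set.Icc (Fin.tail a) (Fin.tail b)) i fun y => f (Fin.cons t y) := by
  funext y
  have e : ∀ s : ℝ, (Fin.cons t y : Fin (p + 1) → ℝ) + s • (Pi.single i.succ 1 : Fin (p + 1) → ℝ) =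
      Fin.cons t (y + s • (Pi.single i 1 : Fin p → ℝ)) := by
    intro s
    funext j
    refine Fin.cases ?_ (fun j => ?_) j
    · simp
    · by_cases h : j = i
      · subst h; simp
      · simp [h]
  simp only [partialWithin, lineDerivWithin, e]
  congr 1
  ext s
  simp only [Set.mem_preimage, cons_mem_Icc, ht, true_and]

/-- On a face `x_0 = t`, the derivatives in the other directions become mixed derivatives of the
slice, which is the form needed for induction on the dimension. -/
lemma opList_succ_cons {t : ℝ} (ht : t ∈ Set.Icc (a 0) (b 0)) (l : List (Fin p))
    (α : Fin (p + 1) → ℕ) (f : (Fin (p + 1) → ℝ) → ℝ) :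
    (fun y : Fin p → ℝ => opList (Set.Icc a b) (l.map Fin.succ) α f (Fin.cons t y)) =
      opList (Set.Icc (Fin.tail a) (Fin.tail b)) l (fun i => α i.succ)
        fun y => f (Fin.cons t y) := by
  induction l with
  | nil => rfl
  | cons i l ih =>
    rw [List.map_cons, opList_cons _ i.succ, opList_cons _ i, ← ih]
    generalize opList (Set.Icc a b) (l.map Fin.succ) α f = g
    induction α i.succ generalizing g with
    | zero => rfl
    | succ m ihm =>
      rw [Function.iterate_succ_apply, Function.iterate_succ_apply, ihm,
        partialWithin_succ_cons ht]

lemma mixedDeriv_succ (s : Set (Fin (p + 1) → ℝ)) (α : Fin (p + 1) → ℕ)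
    (f : (Fin (p + 1) → ℝ) → ℝ) : mixedDeriv s α f =
      (partialWithin s 0)^[α 0] (opList s ((List.finRange p).map Fin.succ) α f) := by
  rw [mixedDeriv_eq_opList, List.finRange_succ, opList_cons]

lemma hasDerivWithinAt_cons (hab : ∀ i, a i < b i) {g : (Fin (p + 1) → ℝ) → ℝ} {n : ℕ}
    (hg : ContDiffOn ℝ ((n + 1 : ℕ) : WithTop ℕ∞) g (Set.Icc a b)) {y : Fin p → ℝ}
    (hy : y ∈ Set.Icc (Fin.tail a) (Fin.tail b)) {t : ℝ} (ht : t ∈ Set.Icc (a 0) (b 0)) :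
    HasDerivWithinAt (fun t : ℝ => g (Fin.cons t y))
      (partialWithin (Set.Icc a b) 0 g (Fin.cons t y)) (Set.Icc (a 0) (b 0)) t := by
  have hx : (Fin.cons t y : Fin (p + 1) → ℝ) ∈ Set.Icc a b := cons_mem_Icc.2 ⟨ht, hy⟩
  have hc : HasDerivWithinAt (fun t : ℝ => (Fin.cons t y : Fin (p + 1) → ℝ)) (Pi.single 0 1)
      (Set.Icc (a 0) (b 0)) t := by
    refine hasDerivWithinAt_pi.2 fun i => Fin.cases ?_ (fun j => ?_) i
    · simp only [Fin.cons_zero, Pi.single_eq_same]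
      exact hasDerivWithinAt_id t _
    · simpa using hasDerivWithinAt_const t _ (y j)
  have h := ((hg.differentiableOn (by simp) _ hx).hasFDerivWithinAt).comp_hasDerivWithinAt t hc
    fun s hs => cons_mem_Icc.2 ⟨hs, hy⟩
  rw [partialWithin_eq hab hg 0 hx]
  exact h

/-- Fubini's theorem in a box. -/
lemma setIntegral_Icc_succ {g : (Fin (p + 1) → ℝ) → ℝ} (hg : ContinuousOn g (Set.Icc a b)) :
    ∫ x in Set.Icc a b, g x = ∫ y in Set.Icc (Fin.tail a) (Fin.tail b),
      ∫ t in Set.Icc (a 0) (b 0), g (Fin.cons t y) := by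
  have he := (volume_preserving_piFinSuccAbove (fun _ : Fin (p + 1) => ℝ) 0).symm
  have hemb := (MeasurableEquiv.piFinSuccAbove (fun _ : Fin (p + 1) => ℝ) 0).symm.measurableEmbedding
  have hcons : ∀ z : ℝ × (Fin p → ℝ), (MeasurableEquiv.piFinSuccAbove
      (fun _ : Fin (p + 1) => ℝ) 0).symm z = Fin.cons z.1 z.2 := fun z => by
    rw [← Fin.insertNth_zero']
    rfl
  have hpre : (MeasurableEquiv.piFinSuccAbove (fun _ : Fin (p + 1) => ℝ) 0).symm ⁻¹' Set.Icc a b =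
      Set.Icc (a 0) (b 0) ×ˢ Set.Icc (Fin.tail a) (Fin.tail b) := by
    ext z
    rw [Set.mem_preimage, hcons, cons_mem_Icc, Set.mem_prod]
  have hint := hg.integrableOn_compact (μ := volume) isCompact_Icc
  rw [← he.setIntegral_preimage_emb hemb, hpre]
  rw [← he.integrableOn_comp_preimage hemb, hpre] at hint
  rw [IntegrableOn, Measure.volume_eq_prod, ← Measure.prod_restrict] at hint
  rw [Measure.volume_eq_prod, ← Measure.prod_restrict]
  refine (integral_prod_symm _ hint).trans ?_
  simp only [Function.comp_apply, hcons]

end slice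

/-! ### The cancellation -/

section cancellation

open Polynomial

/-- If the derivatives up to the order `k` (in each variable) of `f` vanish at the vertices of a
box, then `∂^{(k+1, …, k+1)} f` is orthogonal to all polynomials of degree at most `k` in each
variable. -/
lemma integral_prod_mul_mixedDeriv_eq_zero {k p : ℕ} {a b : Fin p → ℝ} (hab : ∀ i, a i < b i)
    {u : Fin p → ℝ[X]} (hu : ∀ i, (u i).natDegree ≤ k) {f : (Fin p → ℝ) → ℝ}
    (hf : ContDiffOn ℝ ((p * (k + 1) : ℕ) : WithTop ℕ∞) f (Set.Icc a b))
    (hv : ∀ v : Fin p → ℝ, (∀ i, v i = a i ∨ v i = b i) → ∀ α : Fin p → ℕ, (∀ i, α i ≤ k) →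
      mixedDeriv (Set.Icc a b) α f v = 0) :
    ∫ x in Set.Icc a b, (∏ i, (u i).eval (x i)) *
      mixedDeriv (Set.Icc a b) (fun _ => k + 1) f x = 0 := by
  induction p with
  | zero =>
    -- In dimension zero the only point is a vertex, and `β` is the empty multi-index, so the
    -- integrand contains a datum.
    have h : ∀ x, mixedDeriv (Set.Icc a b) (fun _ => k + 1) f x = 0 := fun x =>
      hv x (fun i => i.elim0) (fun _ => 0) fun i => i.elim0
    simp [h]
  | succ p ih =>
    have hab' : ∀ i, Fin.tail a i < Fin.tail b i := fun i => hab i.succ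
    set l := (List.finRange p).map Fin.succ with hl
    have hsum : (l.map fun _ => k + 1).sum = p * (k + 1) := by
      rw [hl, List.map_map]
      simp [Function.comp_def]
    set G := opList (Set.Icc a b) l (fun _ => k + 1) f
    -- The directions other than `0` use up `p (k+1)` of the `(p+1)(k+1)` available derivatives.
    have hfG : ContDiffOn ℝ ((k + 1 : ℕ) : WithTop ℕ∞) G (Set.Icc a b) := by
      refine contDiffOn_opList hab ?_
      rw [hsum]
      convert hf using 2
      ring
    have hGj : ∀ n j, n + j ≤ k + 1 → ContDiffOn ℝ (n : WithTop ℕ∞)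
        ((partialWithin (Set.Icc a b) 0)^[j] G) (Set.Icc a b) := fun n j hj =>
      contDiffOn_iter_partialWithin hab 0 (hfG.of_le (by exact_mod_cast hj))
    have hslice : ∀ j ≤ k + 1, ∀ t ∈ Set.Icc (a 0) (b 0), ContinuousOn
        (fun y : Fin p → ℝ => (partialWithin (Set.Icc a b) 0)^[j] G (Fin.cons t y))
        (Set.Icc (Fin.tail a) (Fin.tail b)) := fun j hj t ht =>
      (hGj 0 j (by omega)).continuousOn.comp (contDiff_cons 0 t).continuous.continuousOn
        fun y hy => cons_mem_Icc.2 ⟨ht, hy⟩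
    have hpol : Continuous fun y : Fin p → ℝ => ∏ i, (u i.succ).eval (y i) :=
      continuous_finsetProd _ fun i _ => (u i.succ).continuous.comp (continuous_apply i)
    -- The boundary terms vanish by the induction hypothesis for the slice of `∂_0^j f`, after
    -- `∂_0^j` has been moved inside the other derivatives.
    have key : ∀ j ≤ k, ∀ t, t = a 0 ∨ t = b 0 →
        ∫ y in Set.Icc (Fin.tail a) (Fin.tail b), (∏ i, (u i.succ).eval (y i)) *
          (partialWithin (Set.Icc a b) 0)^[j] G (Fin.cons t y) = 0 := by
      intro j hj t ht
      have ht' : t ∈ Set.Icc (a 0) (b 0) := by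
        rcases ht with rfl | rfl
        · exact Set.left_mem_Icc.2 (hab 0).le
        · exact Set.right_mem_Icc.2 (hab 0).le
      have hfj : ∀ α : Fin (p + 1) → ℕ, (∀ i, α i ≤ k + 1) →
          ContDiffOn ℝ ((j + (l.map α).sum : ℕ) : WithTop ℕ∞) f (Set.Icc a b) := by
        intro α hα
        refine hf.of_le ?_
        have h1 : (l.map α).sum ≤ p * (k + 1) := by
          rw [← hsum]
          exact List.sum_le_sum fun i _ => hα i
        have h2 : j + (l.map α).sum ≤ (p + 1) * (k + 1) := by
          rw [add_mul]
          omega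
        exact_mod_cast h2
      rw [← ih hab' (fun i => hu i.succ)
        (f := fun y => (partialWithin (Set.Icc a b) 0)^[j] f (Fin.cons t y)) ?_ ?_]
      · refine setIntegral_congr_fun measurableSet_Icc fun y hy => ?_
        rw [mixedDeriv_eq_opList]
        have h1 := iter_partialWithin_opList_comm hab 0 j l (fun _ => k + 1)
          (hfj _ fun _ => le_rfl) (cons_mem_Icc.2 ⟨ht', hy⟩)
        have h2 := congrFun (opList_succ_cons ht' (List.finRange p) (fun _ => k + 1)
          ((partialWithin (Set.Icc a b) 0)^[j] f)) y
        rw [h1]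
        exact congrArg _ h2
      · refine (contDiffOn_iter_partialWithin hab 0 (m := j) ?_).comp (contDiff_cons _ t).contDiffOn
          fun y hy => cons_mem_Icc.2 ⟨ht', hy⟩
        have := hfj (fun _ => k + 1) fun _ => le_rfl
        rwa [hsum, add_comm j] at this
      · intro v hv' α hα
        have hvI : v ∈ Set.Icc (Fin.tail a) (Fin.tail b) := by
          refine ⟨fun i => ?_, fun i => ?_⟩ <;> rcases hv' i with h | h <;> rw [h]
          · exact (hab' i).le
          · exact (hab' i).le
        -- A vertex of the face is a vertex of the box, and the slice of `∂_0^j f` has there the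
        -- datum of `f` with multi-index `(j, α)`.
        have h0 := hv (Fin.cons t v) (Fin.cases (by simpa using ht) fun i => by
            rw [Fin.cons_succ]
            exact hv' i)
          (Fin.cons j α) (Fin.cases (by simpa using hj) fun i => by simpa using hα i)
        rw [mixedDeriv_succ, Fin.cons_zero] at h0
        rw [← h0, mixedDeriv_eq_opList, iter_partialWithin_opList_comm hab 0 j _ (Fin.cons j α)
          (hfj _ (Fin.cases (by simp; omega) fun i => by simpa using (hα i).trans (Nat.le_succ k)))
          (cons_mem_Icc.2 ⟨ht', hvI⟩)]
        have h2 := congrFun (opList_succ_cons ht' (List.finRange p) (Fin.cons j α)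
          ((partialWithin (Set.Icc a b) 0)^[j] f)) v
        simp only [Fin.cons_succ] at h2
        exact h2.symm
    -- The coefficients depend on `u 0` alone, hence not on `y`, and can be pulled out of the
    -- integral over the face.
    obtain ⟨cl, cr, hparts⟩ := exists_integral_by_parts (hab 0).le (hu 0)
    have hinner : ∀ y ∈ Set.Icc (Fin.tail a) (Fin.tail b),
        ∫ t in Set.Icc (a 0) (b 0), (∏ i, (u i).eval ((Fin.cons t y : Fin (p + 1) → ℝ) i)) *
          (partialWithin (Set.Icc a b) 0)^[k + 1] G (Fin.cons t y) =
        ∑ j ∈ Finset.range (k + 1), (cl j * ((∏ i, (u i.succ).eval (y i)) *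
            (partialWithin (Set.Icc a b) 0)^[j] G (Fin.cons (a 0) y)) +
          cr j * ((∏ i, (u i.succ).eval (y i)) *
            (partialWithin (Set.Icc a b) 0)^[j] G (Fin.cons (b 0) y))) := by
      intro y hy
      have h := hparts (fun j t => (partialWithin (Set.Icc a b) 0)^[j] G (Fin.cons t y))
        (fun j hj t ht => by
          simp only [Function.iterate_succ_apply']
          exact hasDerivWithinAt_cons hab (hGj (0 + 1) j (by omega)) hy ht)
        ((hGj 0 (k + 1) (by omega)).continuousOn.comp
          (continuous_pi fun i => Fin.cases (by
            simp only [Fin.cons_zero]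
            exact continuous_id)
            (fun j => by simpa using continuous_const) i).continuousOn
          fun t ht => cons_mem_Icc.2 ⟨ht, hy⟩)
      simp only [Fin.prod_univ_succ, Fin.cons_zero, Fin.cons_succ]
      rw [show (fun t : ℝ => ((u 0).eval t * ∏ i : Fin p, (u i.succ).eval (y i)) *
          (partialWithin (Set.Icc a b) 0)^[k + 1] G (Fin.cons t y)) = fun t =>
          (∏ i : Fin p, (u i.succ).eval (y i)) * ((u 0).eval t *
          (partialWithin (Set.Icc a b) 0)^[k + 1] G (Fin.cons t y)) from by
            funext t; ring, integral_const_mul, h, Finset.mul_sum]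
      refine Finset.sum_congr rfl fun j _ => ?_
      ring
    rw [mixedDeriv_succ, setIntegral_Icc_succ, setIntegral_congr_fun measurableSet_Icc hinner,
      integral_finsetSum]
    · refine Finset.sum_eq_zero fun j hj => ?_
      have hj' : j ≤ k := by
        have := Finset.mem_range.1 hj
        omega
      rw [integral_add, integral_const_mul, integral_const_mul, key j hj' _ (Or.inl rfl),
        key j hj' _ (Or.inr rfl)]
      · simp
      · exact ((hpol.continuousOn.mul (hslice j (by omega) _
          (Set.left_mem_Icc.2 (hab 0).le))).integrableOn_compact isCompact_Icc).const_mul _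
      · exact ((hpol.continuousOn.mul (hslice j (by omega) _
          (Set.right_mem_Icc.2 (hab 0).le))).integrableOn_compact isCompact_Icc).const_mul _
    · intro j hj
      have hj' := Finset.mem_range.1 hj
      exact (((hpol.continuousOn.mul (hslice j (by omega) _
          (Set.left_mem_Icc.2 (hab 0).le))).integrableOn_compact isCompact_Icc).const_mul _).add
        (((hpol.continuousOn.mul (hslice j (by omega) _
          (Set.right_mem_Icc.2 (hab 0).le))).integrableOn_compact isCompact_Icc).const_mul _)
    · exact (continuous_finsetProd _ fun i _ =>
        (u i).continuous.comp (continuous_apply i)).continuousOn.mul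
        (hGj 0 (k + 1) (by omega)).continuousOn

end cancellation

/-! ### The cells of a grid -/

section cells

lemma exists_mem_Icc_castSucc_succ {M : ℕ} (hM : 0 < M) {y : Fin (M + 1) → ℝ} {t : ℝ}
    (ht : t ∈ Set.Icc (y 0) (y (Fin.last M))) :
    ∃ c : Fin M, t ∈ Set.Icc (y c.castSucc) (y c.succ) := by
  by_contra! h
  have h1 : ∀ c : Fin M, y c.castSucc ≤ t → y c.succ < t := fun c hc =>
    not_le.1 fun h' => h c ⟨hc, h'⟩
  -- If no interval contains `t`, the bound `y n ≤ t` passes from node to node, and even strictly to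
  -- the last one.
  have h2 : ∀ n, y n ≤ t := Fin.induction ht.1 fun c hc => (h1 c hc).le
  have h3 := h1 ⟨M - 1, by omega⟩ (h2 _)
  have h4 : (⟨M - 1, by omega⟩ : Fin M).succ = Fin.last M := by
    ext
    simp
    omega
  rw [h4] at h3
  exact absurd ht.2 (not_le.2 h3)

lemma exists_eq_castSucc_or_eq_succ {M : ℕ} (hM : 0 < M) (n : Fin (M + 1)) :
    ∃ c : Fin M, n = c.castSucc ∨ n = c.succ := by
  refine Fin.lastCases ⟨⟨M - 1, by omega⟩, Or.inr ?_⟩ (fun c => ⟨c, Or.inl rfl⟩) n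
  ext
  simp
  omega

variable {p : ℕ} (G : Grid p)

lemma Grid.node_lt (i : Fin p) : G.node i 0 < G.node i (Fin.last (G.size i)) :=
  G.node_strictMono i (Fin.mk_lt_mk.2 (G.size_pos i))

lemma Grid.exists_mem_cell {x : Fin p → ℝ} (hx : x ∈ G.domain) : ∃ c, x ∈ G.cell c := by
  choose c hc using fun i => exists_mem_Icc_castSucc_succ (G.size_pos i) (y := G.node i)
    ⟨hx.1 i, hx.2 i⟩
  exact ⟨c, fun i => (hc i).1, fun i => (hc i).2⟩

lemma Grid.domain_eq : G.domain = ⋃ c, G.cell c :=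
  Set.Subset.antisymm (fun _ hx => Set.mem_iUnion.2 (G.exists_mem_cell hx))
    (Set.iUnion_subset G.cell_subset_domain)

/-- Cells whose indices differ in direction `i` meet at most in a hyperplane orthogonal to that
direction. -/
lemma Grid.aedisjoint_cell : Pairwise (Function.onFun (AEDisjoint volume) G.cell) := by
  have key : ∀ c c' : (i : Fin p) → Fin (G.size i), ∀ i, c i < c' i →
      AEDisjoint volume (G.cell c) (G.cell c') := by
    intro c c' i hi
    refine measure_mono_null (fun x hx => ?_)
      (Measure.pi_hyperplane (fun _ : Fin p => (volume : Measure ℝ)) i (G.node i (c i).succ))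
    have h1 : (c i).succ ≤ (c' i).castSucc := by
      rw [Fin.le_def, Fin.val_succ, Fin.val_castSucc]
      exact hi
    exact le_antisymm (hx.1.2 i) (((G.node_strictMono i).monotone h1).trans (hx.2.1 i))
  intro c c' h
  obtain ⟨i, hi⟩ := Function.ne_iff.1 h
  rcases lt_or_gt_of_ne hi with h | h
  · exact key c c' i h
  · exact (key c' c i h).symm

/-- The interior of a cell. -/
def Grid.openCell (c : (i : Fin p) → Fin (G.size i)) : Set (Fin p → ℝ) :=
  Set.univ.pi fun i => Set.Ioo (G.node i (c i).castSucc) (G.node i (c i).succ)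

lemma Grid.isOpen_openCell (c : (i : Fin p) → Fin (G.size i)) : IsOpen (G.openCell c) :=
  isOpen_set_pi Set.finite_univ fun _ _ => isOpen_Ioo

lemma Grid.openCell_subset (c : (i : Fin p) → Fin (G.size i)) : G.openCell c ⊆ G.cell c :=
  fun _ hx => ⟨fun i => (hx i trivial).1.le, fun i => (hx i trivial).2.le⟩

lemma Grid.openCell_ae_eq (c : (i : Fin p) → Fin (G.size i)) :
    G.openCell c =ᵐ[volume] G.cell c :=
  Measure.univ_pi_Ioo_ae_eq_Icc

lemma Grid.ae_restrict_cell {c : (i : Fin p) → Fin (G.size i)} {q : (Fin p → ℝ) → Prop}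
    (h : ∀ x ∈ G.openCell c, q x) : ∀ᵐ x ∂(volume.restrict (G.cell c)), q x := by
  rw [← Measure.restrict_congr_set (G.openCell_ae_eq c)]
  exact ae_restrict_of_forall_mem (G.isOpen_openCell c).measurableSet h

end cells

/-! ### Derivatives in the domain and in the cells -/

section derivatives

variable {p : ℕ}

/-- Closed sets that miss `x` impose no condition near it. On the others the slopes have the common
limit `L`, and a limit along finitely many sets is a limit along their union. -/
lemma hasLineDerivWithinAt_iUnion {ι : Type*} [Finite ι] {s : ι → Set (Fin p → ℝ)}
    (hs : ∀ c, IsClosed (s c)) {g : (Fin p → ℝ) → ℝ} {L : ℝ} {x v : Fin p → ℝ}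
    (h : ∀ c, x ∈ s c → HasLineDerivWithinAt ℝ g L (s c) x v) :
    HasLineDerivWithinAt ℝ g L (⋃ c, s c) x v := by
  have hc : Continuous fun t : ℝ => x + t • v := by fun_prop
  have key : ∀ c, HasDerivWithinAt (fun t : ℝ => g (x + t • v)) L
      ((fun t : ℝ => x + t • v) ⁻¹' s c) 0 := by
    intro c
    by_cases hx : x ∈ s c
    · exact h c hx
    · refine HasFDerivWithinAt.of_notMem_closure ?_
      rw [((hs c).preimage hc).closure_eq]
      simpa using hx
  rw [HasLineDerivWithinAt, Set.preimage_iUnion]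
  simp only [hasDerivWithinAt_iff_tendsto_slope] at key ⊢
  rw [Set.iUnion_sdiff, nhdsWithin_iUnion]
  exact Filter.tendsto_iSup.2 key

variable {G : Grid p} {k : ℕ} {N : ℕ∞} {hN : ((p * (k + 1) : ℕ) : ℕ∞) ≤ N} {φ : G.domain → ℝ}
  (hφ : φ ∈ smoothSpace G k N hN)

include hφ

lemma contDiffOn_cell (c : (i : Fin p) → Fin (G.size i)) {n : ℕ} (hn : n ≤ p * (k + 1)) :
    ContDiffOn ℝ (n : WithTop ℕ∞) (zeroExt φ) (G.cell c) := by
  refine (hφ.1 c).of_le ?_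
  have h : (n : ℕ∞) ≤ N := le_trans (by exact_mod_cast hn) hN
  exact_mod_cast h

/-- Setting `α` to zero outside `l` turns the composition into some `∂^α` with `α ∈ {0, …, k}ᵖ`, to
which the no-jump condition applies. -/
lemma opList_cell_eq {l l' : List (Fin p)} (hl : List.finRange p = l' ++ l) {α : Fin p → ℕ}
    (hα : ∀ i ∈ l, α i ≤ k) (c c' : (i : Fin p) → Fin (G.size i)) {x : Fin p → ℝ}
    (hx : x ∈ G.cell c) (hx' : x ∈ G.cell c') :
    opList (G.cell c) l α (zeroExt φ) x = opList (G.cell c') l α (zeroExt φ) x := by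
  have hnd := List.nodup_finRange p
  rw [hl, List.nodup_append'] at hnd
  have key : ∀ s, mixedDeriv s (fun i => if i ∈ l then α i else 0) (zeroExt φ) =
      opList s l α (zeroExt φ) := by
    intro s
    rw [mixedDeriv_eq_opList, hl, opList_append, opList_eq_self s (l := l'),
      opList_congr_index s (l := l) (α' := α)]
    · intro i hi
      rw [if_pos hi]
    · intro i hi
      rw [if_neg fun h => hnd.2.2 hi h]
  rw [← key, ← key]
  refine hφ.2 _ (fun i => ?_) c c' x ⟨hx, hx'⟩
  split_ifs with h
  · exact hα i h
  · exact Nat.zero_le _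

/-- Derivatives are added one at a time. Near a point shared by several cells, the function obtained
so far agrees with a `C^1` function on each of them; the no-jump condition equates the next
derivatives, which then glue to a derivative in the domain. Working with suffixes of `List.finRange
p` makes every intermediate composition subject to that condition. -/
lemma opList_domain_eq {l l' : List (Fin p)} (hl : List.finRange p = l' ++ l) {α : Fin p → ℕ}
    (hα : ∀ i ∈ l, α i ≤ k) (c : (i : Fin p) → Fin (G.size i)) :
    Set.EqOn (opList G.domain l α (zeroExt φ)) (opList (G.cell c) l α (zeroExt φ)) (G.cell c) := by
  induction l generalizing l' c with
  | nil => exact fun _ _ => rfl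
  | cons i l ih =>
    have hnd := List.nodup_finRange p
    rw [hl, List.nodup_append', List.nodup_cons] at hnd
    have hil : i ∉ l := hnd.2.1.1
    have hlen : (i :: l).length ≤ p := by
      have := congrArg List.length hl
      rw [List.length_finRange, List.length_append] at this
      omega
    have ih' := fun c => ih (l' := l' ++ [i]) (by simpa using hl)
      (fun j hj => hα j (List.mem_cons_of_mem _ hj)) c
    have key : ∀ m ≤ k, ∀ c, Set.EqOn
        ((partialWithin G.domain i)^[m] (opList G.domain l α (zeroExt φ)))
        ((partialWithin (G.cell c) i)^[m] (opList (G.cell c) l α (zeroExt φ))) (G.cell c) := by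
      intro m
      induction m with
      | zero => exact fun _ c => ih' c
      | succ m ihm =>
        intro hm c x hx
        -- Including the derivative about to be taken, the total order is within the smoothness `p
        -- (k+1)`, so the function to be differentiated is `C^1` on each cell.
        have hsum : 1 + m + (l.map α).sum ≤ p * (k + 1) := by
          have h1 : (l.map α).sum ≤ l.length * k := by
            have := List.sum_le_card_nsmul (l.map α) k (by
              simpa using fun j hj => hα j (List.mem_cons_of_mem _ hj))
            simpa using this
          rw [List.length_cons] at hlen
          calc 1 + m + (l.map α).sum ≤ (l.length + 1) * (k + 1) := by
                rw [add_mul, mul_add]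
                omega
            _ ≤ p * (k + 1) := Nat.mul_le_mul_right _ hlen
        have hupd : ∀ c, partialWithin (G.cell c) i ((partialWithin (G.cell c) i)^[m]
            (opList (G.cell c) l α (zeroExt φ))) =
            opList (G.cell c) (i :: l) (Function.update α i (m + 1)) (zeroExt φ) := by
          intro c
          rw [opList_cons, Function.update_self, Function.iterate_succ_apply',
            opList_congr_index (G.cell c) (α := Function.update α i (m + 1)) (α' := α) fun j hj =>
              Function.update_of_ne (ne_of_mem_of_not_mem hj hil) _ _]
        have hjump : ∀ c', x ∈ G.cell c' → partialWithin (G.cell c') i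
            ((partialWithin (G.cell c') i)^[m] (opList (G.cell c') l α (zeroExt φ))) x =
            partialWithin (G.cell c) i
            ((partialWithin (G.cell c) i)^[m] (opList (G.cell c) l α (zeroExt φ))) x := by
          intro c' hx'
          rw [hupd, hupd]
          refine opList_cell_eq hφ hl (fun j hj => ?_) c' c hx' hx
          by_cases h : j = i
          · subst h
            rwa [Function.update_self]
          · rw [Function.update_of_ne h]
            exact hα j hj
        rw [Function.iterate_succ_apply', Function.iterate_succ_apply']
        have hderiv : HasLineDerivWithinAt ℝ
            ((partialWithin G.domain i)^[m] (opList G.domain l α (zeroExt φ)))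
            (partialWithin (G.cell c) i ((partialWithin (G.cell c) i)^[m]
              (opList (G.cell c) l α (zeroExt φ))) x) G.domain x (Pi.single i 1) := by
          have h : ∀ g : (Fin p → ℝ) → ℝ, ∀ L, (∀ c', x ∈ G.cell c' → HasLineDerivWithinAt ℝ g L
              (G.cell c') x (Pi.single i 1)) →
              HasLineDerivWithinAt ℝ g L G.domain x (Pi.single i 1) := fun g L h => by
            rw [G.domain_eq]
            exact hasLineDerivWithinAt_iUnion (fun _ => isClosed_Icc) h
          refine h _ _ fun c' hx' => ?_
          have hC : ContDiffOn ℝ ((0 + 1 : ℕ) : WithTop ℕ∞) ((partialWithin (G.cell c') i)^[m]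
              (opList (G.cell c') l α (zeroExt φ))) (G.cell c') :=
            contDiffOn_iter_partialWithin (G.cell_lt c') i
              (contDiffOn_opList (G.cell_lt c') (contDiffOn_cell hφ c' (by omega)))
          have h1 := hasLineDerivWithinAt_of_contDiffOn hC hx' (Pi.single i 1)
          rw [← hjump c' hx', show partialWithin (G.cell c') i ((partialWithin (G.cell c') i)^[m]
            (opList (G.cell c') l α (zeroExt φ))) x = _ from
              partialWithin_eq (G.cell_lt c') hC i hx']
          exact h1.congr (ihm (by omega) c') (ihm (by omega) c' hx')
        exact hderiv.derivWithin (uniqueDiffWithinAt_line G.node_lt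
          (G.cell_subset_domain c hx) i)
    exact key (α i) (hα i List.mem_cons_self) c

/-- The derivatives `∂^α` in the domain agree with those in the cells for `α ∈ {0, …, k}ᵖ`. -/
lemma mixedDeriv_domain_eq {α : Fin p → ℕ} (hα : ∀ i, α i ≤ k)
    (c : (i : Fin p) → Fin (G.size i)) :
    Set.EqOn (mixedDeriv G.domain α (zeroExt φ)) (mixedDeriv (G.cell c) α (zeroExt φ))
      (G.cell c) :=
  opList_domain_eq hφ (l' := []) rfl (fun i _ => hα i) c

-- Only the open cell is possible here, since `∂^β` may jump across the faces.
omit hφ in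
lemma topDeriv_eq (φ : G.domain → ℝ) (c : (i : Fin p) → Fin (G.size i)) :
    Set.EqOn (topDeriv G k φ) (mixedDeriv (G.cell c) (fun _ => k + 1) (zeroExt φ))
      (G.openCell c) :=
  opList_eq_of_isOpen (G.isOpen_openCell c)
    ((G.openCell_subset c).trans (G.cell_subset_domain c)) (G.openCell_subset c) _ _
    fun _ _ => rfl

lemma continuousOn_mixedDeriv_cell (c : (i : Fin p) → Fin (G.size i)) :
    ContinuousOn (mixedDeriv (G.cell c) (fun _ => k + 1) (zeroExt φ)) (G.cell c) := by
  refine ((isDiffOp_mixedDeriv (G.cell_lt c) _).2 0 _ (contDiffOn_cell hφ c ?_)).1.continuousOn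
  simp

end derivatives

/-! ### The interpolant -/

section interpolant

open Polynomial

variable {p : ℕ} (G : Grid p) (k : ℕ)

/-- Indices of the data: a node and a multi-index in `{0, …, k}ᵖ`. -/
abbrev DataIndex : Type := (i : Fin p) → Fin (G.size i + 1) × Fin (k + 1)

variable {G k}

/-- The node that belongs to an index. -/
def nodeAt (m : DataIndex G k) : Fin p → ℝ := fun i => G.node i (m i).1

/-- The node of the index `m` is a vertex of the cell `c`. -/
def IsVertex (c : (i : Fin p) → Fin (G.size i)) (m : DataIndex G k) : Prop :=
  ∀ i, (m i).1 = (c i).castSucc ∨ (m i).1 = (c i).succ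

lemma nodeAt_mem_cell {c : (i : Fin p) → Fin (G.size i)} {m : DataIndex G k}
    (h : IsVertex c m) : nodeAt m ∈ G.cell c := by
  refine ⟨fun i => ?_, fun i => ?_⟩ <;> rcases h i with h | h <;> simp only [nodeAt, h]
  · exact le_rfl
  · exact (G.cell_lt c i).le
  · exact (G.cell_lt c i).le
  · exact le_rfl

lemma exists_isVertex (m : DataIndex G k) : ∃ c, IsVertex c m :=
  Classical.skolem.1 fun i => exists_eq_castSucc_or_eq_succ (G.size_pos i) (m i).1

lemma exists_vertex_eq_nodeAt {c : (i : Fin p) → Fin (G.size i)} {m : DataIndex G k}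
    (h : IsVertex c m) : ∃ q, G.vertex c q = nodeAt m := by
  classical
  refine ⟨fun i => if (m i).1 = (c i).castSucc then 0 else 1, funext fun i => ?_⟩
  by_cases hi : (m i).1 = (c i).castSucc
  · simp [Grid.vertex, nodeAt, hi]
  · simp only [Grid.vertex, nodeAt, hi, if_false, one_ne_zero]
    rw [(h i).resolve_left hi]

lemma exists_nodeAt_eq_vertex (c : (i : Fin p) → Fin (G.size i)) (q : Fin p → Fin 2)
    {α : Fin p → ℕ} (hα : ∀ i, α i ≤ k) :
    ∃ m : DataIndex G k, IsVertex c m ∧ nodeAt m = G.vertex c q ∧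
      (fun i => ((m i).2 : ℕ)) = α := by
  refine ⟨fun i => (if q i = 0 then (c i).castSucc else (c i).succ,
    ⟨α i, Nat.lt_succ_of_le (hα i)⟩), fun i => ?_, funext fun i => ?_, rfl⟩
  · by_cases h : q i = 0 <;> simp [h]
  · by_cases h : q i = 0 <;> simp [nodeAt, Grid.vertex, h]

lemma Grid.uniqueLineDiffOn_cell (G : Grid p) (c : (i : Fin p) → Fin (G.size i)) :
    UniqueLineDiffOn (G.cell c) :=
  uniqueLineDiffOn_Icc (G.cell_lt c)

/-- The interpolating polynomial of the data `d` in the cell `c`. -/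
def cellInterpolant (d : DataIndex G k → ℝ) (c : (i : Fin p) → Fin (G.size i)) :
    (Fin p → ℝ) → ℝ :=
  tensorSum Finset.univ d fun m i => hermiteBasis k (G.node i) (c i) (m i)

lemma mixedDeriv_cellInterpolant {s : Set (Fin p → ℝ)} (hs : UniqueLineDiffOn s)
    (d : DataIndex G k → ℝ) (c : (i : Fin p) → Fin (G.size i)) (α : Fin p → ℕ) {x : Fin p → ℝ}
    (hx : x ∈ s) : mixedDeriv s α (cellInterpolant d c) x = ∑ m, d m *
      ∏ i, (derivative^[α i] (hermiteBasis k (G.node i) (c i) (m i))).eval (x i) :=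
  mixedDeriv_tensorSum hs _ _ _ α hx

/-- The derivatives of the local interpolants have no jumps. -/
lemma mixedDeriv_cellInterpolant_eq (d : DataIndex G k → ℝ) {α : Fin p → ℕ} (hα : ∀ i, α i ≤ k)
    {c c' : (i : Fin p) → Fin (G.size i)} {x : Fin p → ℝ} (hx : x ∈ G.cell c)
    (hx' : x ∈ G.cell c') : mixedDeriv (G.cell c) α (cellInterpolant d c) x =
      mixedDeriv (G.cell c') α (cellInterpolant d c') x := by
  rw [mixedDeriv_cellInterpolant (G.uniqueLineDiffOn_cell c) d c α hx,
    mixedDeriv_cellInterpolant (G.uniqueLineDiffOn_cell c') d c' α hx']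
  refine Finset.sum_congr rfl fun m _ => congrArg _ (Finset.prod_congr rfl fun i _ => ?_)
  exact hermiteBasis_eq (G.node_strictMono i) ⟨hx.1 i, hx.2 i⟩ ⟨hx'.1 i, hx'.2 i⟩ (m i) (hα i)

/-- The local interpolants attain the data at the vertices. -/
lemma mixedDeriv_cellInterpolant_nodeAt {s : Set (Fin p → ℝ)} (hs : UniqueLineDiffOn s)
    (d : DataIndex G k → ℝ) {c : (i : Fin p) → Fin (G.size i)} {m : DataIndex G k}
    (hm : IsVertex c m) (hx : nodeAt m ∈ s) :
    mixedDeriv s (fun i => (m i).2) (cellInterpolant d c) (nodeAt m) = d m := by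
  rw [mixedDeriv_cellInterpolant hs d c _ hx]
  have h : ∀ m' : DataIndex G k, ∀ i, (derivative^[(m i).2] (hermiteBasis k (G.node i) (c i)
      (m' i))).eval (nodeAt m i) = if m' i = m i then 1 else 0 := fun m' i =>
    (isHermiteBasis k (G.node_strictMono i) (c i) (m' i)).2.2 _ (hm i) _
  simp only [h]
  rw [Finset.sum_eq_single m]
  · simp
  · intro m' _ hne
    obtain ⟨i, hi⟩ := Function.ne_iff.1 hne
    rw [Finset.prod_eq_zero (Finset.mem_univ i) (if_neg hi), mul_zero]
  · simp

/-- Basis polynomials of nodes outside the cell are zero, so data indexed by all nodes of the grid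
can be used in every cell at once. -/
lemma cellInterpolant_congr {d d' : DataIndex G k → ℝ} {c : (i : Fin p) → Fin (G.size i)}
    (h : ∀ m, IsVertex c m → d m = d' m) : cellInterpolant d c = cellInterpolant d' c := by
  funext x
  refine Finset.sum_congr rfl fun m _ => ?_
  by_cases hm : IsVertex c m
  · rw [h m hm]
  · simp only [IsVertex, not_forall, not_or] at hm
    obtain ⟨i, h1, h2⟩ := hm
    rw [Finset.prod_eq_zero (Finset.mem_univ i), mul_zero, mul_zero]
    simp only [(isHermiteBasis k (G.node_strictMono i) (c i) (m i)).2.1 h1 h2, eval_zero]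

/-- A polynomial of degree at most `2 k + 1` in each variable is its own interpolant. -/
lemma eval_eq_cellInterpolant {Q : MvPolynomial (Fin p) ℝ} (hQ : ∀ i, Q.degreeOf i ≤ 2 * k + 1)
    (c : (i : Fin p) → Fin (G.size i)) (x : Fin p → ℝ) :
    MvPolynomial.eval x Q = cellInterpolant (fun m : DataIndex G k =>
      mixedDeriv Set.univ (fun i => (m i).2) (fun x => MvPolynomial.eval x Q) (nodeAt m)) c x := by
  have h1 : ∀ m : DataIndex G k, mixedDeriv Set.univ (fun i => (m i).2)
      (fun x => MvPolynomial.eval x Q) (nodeAt m) = ∑ e ∈ Q.support, Q.coeff e *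
        ∏ i, (derivative^[(m i).2] (X ^ e i : ℝ[X])).eval (G.node i (m i).1) := fun m => by
    rw [eval_eq_tensorSum]
    exact mixedDeriv_tensorSum uniqueLineDiffOn_univ _ _ _ _ (Set.mem_univ _)
  have h2 : ∀ e ∈ Q.support, ∀ i, x i ^ e i = ∑ m : Fin (G.size i + 1) × Fin (k + 1),
      (derivative^[m.2] (X ^ e i : ℝ[X])).eval (G.node i m.1) *
        (hermiteBasis k (G.node i) (c i) m).eval (x i) := by
    intro e he i
    have h := congrArg (eval (x i)) (sum_hermiteBasis (k := k) (G.node_strictMono i) (c i)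
      (u := X ^ e i) (by
        rw [natDegree_X_pow]
        exact (MvPolynomial.degreeOf_le_iff.1 le_rfl e he).trans (hQ i)))
    simpa [eval_finsetSum] using h
  simp only [cellInterpolant, tensorSum, h1]
  rw [MvPolynomial.eval_eq']
  simp only [Finset.sum_mul]
  rw [Finset.sum_comm]
  refine Finset.sum_congr rfl fun e he => ?_
  -- For each monomial, the product of the `p` univariate Hermite expansions is multiplied out into
  -- a sum over `DataIndex`.
  rw [Finset.prod_congr rfl fun i _ => h2 e he i, Finset.prod_univ_sum, Fintype.piFinset_univ,
    Finset.mul_sum]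
  refine Finset.sum_congr rfl fun m _ => ?_
  rw [Finset.prod_mul_distrib, mul_assoc]

variable (G) in
/-- A cell that contains the given point. -/
def cellOf (x : G.domain) : (i : Fin p) → Fin (G.size i) := (G.exists_mem_cell x.2).choose

lemma mem_cell_cellOf (x : G.domain) : (x : Fin p → ℝ) ∈ G.cell (cellOf G x) :=
  (G.exists_mem_cell x.2).choose_spec

/-- The global interpolant of the data `d`. -/
def interpolant (d : DataIndex G k → ℝ) : G.domain → ℝ := fun x =>
  cellInterpolant d (cellOf G x) x

/-- The choice made by `cellOf` is immaterial: this is the absence of jumps for `α = 0`. -/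
lemma interpolant_eq (d : DataIndex G k → ℝ) {c : (i : Fin p) → Fin (G.size i)} {x : G.domain}
    (hx : (x : Fin p → ℝ) ∈ G.cell c) : interpolant d x = cellInterpolant d c x := by
  have key : ∀ c : (i : Fin p) → Fin (G.size i), mixedDeriv (G.cell c) (fun _ => 0)
      (cellInterpolant d c) = cellInterpolant d c := fun c => by
    rw [mixedDeriv_eq_opList, opList_eq_self _ fun _ _ => rfl]
  have h := mixedDeriv_cellInterpolant_eq d (α := fun _ => 0) (fun _ => Nat.zero_le k)
    (mem_cell_cellOf x) hx
  rwa [key, key] at h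

lemma zeroExt_apply {s : Set (Fin p → ℝ)} (f : s → ℝ) (x : s) : zeroExt f x = f x :=
  Subtype.val_injective.extend_apply _ _ _

lemma zeroExt_interpolant (d : DataIndex G k → ℝ) (c : (i : Fin p) → Fin (G.size i)) :
    Set.EqOn (zeroExt (interpolant d)) (cellInterpolant d c) (G.cell c) := fun x hx =>
  (zeroExt_apply _ ⟨x, G.cell_subset_domain c hx⟩).trans (interpolant_eq d hx)

lemma mixedDeriv_interpolant (d : DataIndex G k → ℝ) (c : (i : Fin p) → Fin (G.size i))
    (α : Fin p → ℕ) : Set.EqOn (mixedDeriv (G.cell c) α (zeroExt (interpolant d)))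
      (mixedDeriv (G.cell c) α (cellInterpolant d c)) (G.cell c) :=
  opList_congr _ _ _ (zeroExt_interpolant d c)

variable (N : ℕ∞) (hN : ((p * (k + 1) : ℕ) : ℕ∞) ≤ N)

lemma interpolant_mem (d : DataIndex G k → ℝ) : interpolant d ∈ smoothSpace G k N hN := by
  refine ⟨fun c => ?_, fun α hα c c' x hx => ?_⟩
  · exact (contDiff_tensorSum _ _ _).contDiffOn.congr (zeroExt_interpolant d c)
  · rw [mixedDeriv_interpolant d c α hx.1, mixedDeriv_interpolant d c' α hx.2]
    exact mixedDeriv_cellInterpolant_eq d hα hx.1 hx.2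

/-- The interpolant as a linear function of the data. -/
def interpolantMap : (DataIndex G k → ℝ) →ₗ[ℝ] smoothSpace G k N hN where
  toFun d := ⟨interpolant d, interpolant_mem N hN d⟩
  map_add' d d' := by
    refine Subtype.ext (funext fun x => ?_)
    simp [interpolant, cellInterpolant, tensorSum, add_mul, Finset.sum_add_distrib]
  map_smul' r d := by
    refine Subtype.ext (funext fun x => ?_)
    simp [interpolant, cellInterpolant, tensorSum, Finset.mul_sum, mul_assoc]

variable {N hN}

/-- The Hermite data of a function. -/
def hermiteData (φ : G.domain → ℝ) (m : DataIndex G k) : ℝ :=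
  mixedDeriv G.domain (fun i => (m i).2) (zeroExt φ) (nodeAt m)

/-- In a cell the function is smooth, so the linearity of `∂^α` becomes available for the data. -/
lemma hermiteData_eq {φ : G.domain → ℝ} (hφ : φ ∈ smoothSpace G k N hN) {m : DataIndex G k}
    {c : (i : Fin p) → Fin (G.size i)} (hm : IsVertex c m) : hermiteData φ m =
      mixedDeriv (G.cell c) (fun i => (m i).2) (zeroExt φ) (nodeAt m) :=
  mixedDeriv_domain_eq hφ (fun i => Nat.le_of_lt_succ (m i).2.2) c (nodeAt_mem_cell hm)

lemma mixedDeriv_cell_add {f g : G.domain → ℝ} (hf : f ∈ smoothSpace G k N hN)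
    (hg : g ∈ smoothSpace G k N hN) {α : Fin p → ℕ} (hα : ∀ i, α i ≤ k + 1)
    (c : (i : Fin p) → Fin (G.size i)) : Set.EqOn (mixedDeriv (G.cell c) α (zeroExt (f + g)))
      (mixedDeriv (G.cell c) α (zeroExt f) + mixedDeriv (G.cell c) α (zeroExt g)) (G.cell c) := by
  have hs : 0 + ∑ i, α i ≤ p * (k + 1) := by
    simpa using Finset.sum_le_sum fun i (_ : i ∈ Finset.univ) => hα i
  rw [zeroExt_add]
  exact ((isDiffOp_mixedDeriv (G.cell_lt c) α).2 0 _ (contDiffOn_cell hf c hs)).2.2.1 _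
    (contDiffOn_cell hg c hs)

lemma mixedDeriv_cell_smul {f : G.domain → ℝ} (hf : f ∈ smoothSpace G k N hN) (r : ℝ)
    {α : Fin p → ℕ} (hα : ∀ i, α i ≤ k + 1)
    (c : (i : Fin p) → Fin (G.size i)) : Set.EqOn (mixedDeriv (G.cell c) α (zeroExt (r • f)))
      (r • mixedDeriv (G.cell c) α (zeroExt f)) (G.cell c) := by
  have hs : 0 + ∑ i, α i ≤ p * (k + 1) := by
    simpa using Finset.sum_le_sum fun i (_ : i ∈ Finset.univ) => hα i
  rw [zeroExt_smul]
  exact ((isDiffOp_mixedDeriv (G.cell_lt c) α).2 0 _ (contDiffOn_cell hf c hs)).2.1 r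

variable (N hN) in
/-- The Hermite data as a linear map. -/
def hermiteDataMap : smoothSpace G k N hN →ₗ[ℝ] (DataIndex G k → ℝ) where
  toFun φ := hermiteData φ
  map_add' f g := by
    funext m
    obtain ⟨c, hc⟩ := exists_isVertex m
    rw [Pi.add_apply, hermiteData_eq (f + g).2 hc, hermiteData_eq f.2 hc, hermiteData_eq g.2 hc]
    exact mixedDeriv_cell_add f.2 g.2 (fun i => (m i).2.2.le) c (nodeAt_mem_cell hc)
  map_smul' r f := by
    funext m
    obtain ⟨c, hc⟩ := exists_isVertex m
    rw [Pi.smul_apply, hermiteData_eq (r • f).2 hc, hermiteData_eq f.2 hc]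
    exact mixedDeriv_cell_smul f.2 r (fun i => (m i).2.2.le) c (nodeAt_mem_cell hc)

lemma hermiteData_interpolant (d : DataIndex G k → ℝ) :
    hermiteDataMap N hN (interpolantMap N hN d) = d := by
  funext m
  obtain ⟨c, hc⟩ := exists_isVertex m
  refine (hermiteData_eq (interpolant_mem N hN d) hc).trans ?_
  rw [mixedDeriv_interpolant d c _ (nodeAt_mem_cell hc)]
  exact mixedDeriv_cellInterpolant_nodeAt (G.uniqueLineDiffOn_cell c) d hc
    (nodeAt_mem_cell hc)

variable (G k N hN) in
/-- The projection `φ ↦ H_φ`. -/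
def hermiteProj : smoothSpace G k N hN →ₗ[ℝ] smoothSpace G k N hN :=
  interpolantMap N hN ∘ₗ hermiteDataMap N hN

/-- Uniqueness: the polynomial of a cell reproduces itself from its derivatives at the nodes, and
only those at the vertices of the cell, which are prescribed, matter. -/
lemma isHermiteInterpolant_iff (φ H : G.domain → ℝ) :
    IsHermiteInterpolant G k φ H ↔ H = interpolant (hermiteData (k := k) φ) := by
  constructor
  · intro h
    funext x
    obtain ⟨Q, hdeg, heval, hdata⟩ := h (cellOf G x)
    rw [heval x (mem_cell_cellOf x), eval_eq_cellInterpolant hdeg (cellOf G x), interpolant]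
    refine congrFun (cellInterpolant_congr fun m hm => ?_) _
    obtain ⟨q, hq⟩ := exists_vertex_eq_nodeAt hm
    rw [hermiteData, ← hq]
    exact hdata q _ fun i => Nat.le_of_lt_succ (m i).2.2
  · rintro rfl c
    obtain ⟨Q, hdeg, heval⟩ := exists_mvPolynomial_of_tensorSum (n := 2 * k + 1) Finset.univ
      (hermiteData (G := G) (k := k) φ) (fun m i => hermiteBasis k (G.node i) (c i) (m i))
      fun m i => (isHermiteBasis k (G.node_strictMono i) (c i) (m i)).1
    refine ⟨Q, hdeg, fun x hx => ?_, fun q α hα => ?_⟩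
    · rw [interpolant_eq _ hx, heval]
      rfl
    · obtain ⟨m, hm, hq, rfl⟩ := exists_nodeAt_eq_vertex c q hα
      rw [← hq, show (fun x => MvPolynomial.eval x Q) = cellInterpolant (hermiteData φ) c from
        funext heval]
      exact mixedDeriv_cellInterpolant_nodeAt uniqueLineDiffOn_univ _ hm (Set.mem_univ _)

end interpolant

/-! ### The bilinear form -/

section bilinear

open Polynomial

variable {p : ℕ} {G : Grid p} {k : ℕ} {N : ℕ∞} {hN : ((p * (k + 1) : ℕ) : ℕ∞) ≤ N}

lemma ae_restrict_domain {q : (Fin p → ℝ) → Prop} (h : ∀ c, ∀ x ∈ G.openCell c, q x) :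
    ∀ᵐ x ∂(volume.restrict G.domain), q x := by
  rw [G.domain_eq, ae_restrict_iUnion_iff]
  exact fun c => G.ae_restrict_cell (h c)

lemma topDeriv_add {f g : G.domain → ℝ} (hf : f ∈ smoothSpace G k N hN)
    (hg : g ∈ smoothSpace G k N hN) : ∀ᵐ x ∂(volume.restrict G.domain),
      topDeriv G k (f + g) x = topDeriv G k f x + topDeriv G k g x := by
  refine ae_restrict_domain fun c x hx => ?_
  rw [topDeriv_eq _ c hx, topDeriv_eq _ c hx, topDeriv_eq _ c hx]
  exact mixedDeriv_cell_add hf hg (fun _ => le_rfl) c (G.openCell_subset c hx)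

lemma topDeriv_smul {f : G.domain → ℝ} (hf : f ∈ smoothSpace G k N hN) (r : ℝ) :
    ∀ᵐ x ∂(volume.restrict G.domain), topDeriv G k (r • f) x = r * topDeriv G k f x := by
  refine ae_restrict_domain fun c x hx => ?_
  rw [topDeriv_eq _ c hx, topDeriv_eq _ c hx]
  exact mixedDeriv_cell_smul hf r (fun _ => le_rfl) c (G.openCell_subset c hx)

lemma integrableOn_topDeriv_mul {f g : G.domain → ℝ} (hf : f ∈ smoothSpace G k N hN)
    (hg : g ∈ smoothSpace G k N hN) :
    IntegrableOn (fun x => topDeriv G k f x * topDeriv G k g x) G.domain := by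
  rw [G.domain_eq, integrableOn_finite_iUnion]
  intro c
  have h := ((continuousOn_mixedDeriv_cell hf c).mul
    (continuousOn_mixedDeriv_cell hg c)).integrableOn_compact (μ := volume) isCompact_Icc
  refine Integrable.congr h (G.ae_restrict_cell fun x hx => ?_)
  simp only [topDeriv_eq f c hx, topDeriv_eq g c hx, Pi.mul_apply]

variable (G k N hN) in
/-- The bilinear form `B`. -/
def stabilityForm : LinearMap.BilinForm ℝ (smoothSpace G k N hN) :=
  LinearMap.mk₂ ℝ (fun f g => ∫ x in G.domain, topDeriv G k f x * topDeriv G k g x)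
    (fun f f' g => by
      rw [← integral_add (integrableOn_topDeriv_mul f.2 g.2) (integrableOn_topDeriv_mul f'.2 g.2)]
      refine integral_congr_ae ((topDeriv_add f.2 f'.2).mono fun x hx => ?_)
      simp only [Submodule.coe_add, hx, add_mul])
    (fun r f g => by
      rw [smul_eq_mul, ← integral_const_mul]
      refine integral_congr_ae ((topDeriv_smul f.2 r).mono fun x hx => ?_)
      simp only [Submodule.coe_smul, hx, mul_assoc])
    (fun f g g' => by
      rw [← integral_add (integrableOn_topDeriv_mul f.2 g.2) (integrableOn_topDeriv_mul f.2 g'.2)]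
      refine integral_congr_ae ((topDeriv_add g.2 g'.2).mono fun x hx => ?_)
      simp only [Submodule.coe_add, hx, mul_add])
    (fun r f g => by
      rw [smul_eq_mul, ← integral_const_mul]
      refine integral_congr_ae ((topDeriv_smul g.2 r).mono fun x hx => ?_)
      simp only [Submodule.coe_smul, hx]
      ring)

lemma stabilityForm_apply (f g : smoothSpace G k N hN) : stabilityForm G k N hN f g =
    ∫ x in G.domain, topDeriv G k f x * topDeriv G k g x := rfl

lemma isPosSemidef_stabilityForm : (stabilityForm G k N hN).IsPosSemidef where
  eq f g := by
    simp only [stabilityForm_apply, mul_comm]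
  nonneg f := by
    rw [stabilityForm_apply]
    exact integral_nonneg fun x => mul_self_nonneg _

/-- A function without Hermite data is orthogonal to all interpolants on every cell. -/
lemma setIntegral_cell_eq_zero (d : DataIndex G k → ℝ) {w : smoothSpace G k N hN}
    (hw : hermiteDataMap N hN w = 0) (c : (i : Fin p) → Fin (G.size i)) :
    ∫ x in G.cell c, topDeriv G k (interpolant d) x * topDeriv G k w x = 0 := by
  set W := mixedDeriv (G.cell c) (fun _ => k + 1) (zeroExt (w : G.domain → ℝ))
  have hWc : ContinuousOn W (G.cell c) := continuousOn_mixedDeriv_cell w.2 c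
  have hb := fun (m : DataIndex G k) i => isHermiteBasis k (G.node_strictMono i) (c i) (m i)
  have key : ∀ m : DataIndex G k, ∫ x in G.cell c,
      (∏ i, (derivative^[k + 1] (hermiteBasis k (G.node i) (c i) (m i))).eval (x i)) * W x = 0 := by
    intro m
    refine integral_prod_mul_mixedDeriv_eq_zero (k := k) (G.cell_lt c) (fun i => ?_)
      (contDiffOn_cell w.2 c le_rfl) fun v hv α hα => ?_
    -- The degree drops from at most `2k+1` to at most `k`.
    · have h1 := natDegree_iterate_derivative (hermiteBasis k (G.node i) (c i) (m i)) (k + 1)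
      have h2 := (hb m i).1
      omega
    · classical
      obtain ⟨m, hm, hq, rfl⟩ := exists_nodeAt_eq_vertex c
        (fun i => if v i = G.node i (c i).castSucc then 0 else 1) hα
      have hv' : nodeAt m = v := by
        rw [hq]
        funext i
        by_cases h : v i = G.node i (c i).castSucc
        · simp [Grid.vertex, h]
        · simp only [Grid.vertex, h, if_false, one_ne_zero]
          exact ((hv i).resolve_left h).symm
      rw [← hv']
      exact (hermiteData_eq w.2 hm).symm.trans (congrFun hw m)
  have hint : ∀ m : DataIndex G k, IntegrableOn (fun x => d m * ((∏ i, (derivative^[k + 1]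
      (hermiteBasis k (G.node i) (c i) (m i))).eval (x i)) * W x)) (G.cell c) := fun m =>
    (((continuous_finsetProd _ fun i _ => (Polynomial.continuous _).comp
      (continuous_apply i)).continuousOn.mul hWc).integrableOn_compact isCompact_Icc).const_mul _
  have hsum : ∫ x in G.cell c, topDeriv G k (interpolant d) x * topDeriv G k w x =
      ∫ x in G.cell c, ∑ m : DataIndex G k, d m * ((∏ i, (derivative^[k + 1]
        (hermiteBasis k (G.node i) (c i) (m i))).eval (x i)) * W x) := by
    -- The cell boundary is discarded as a null set, because `topDeriv` is controlled in the open
    -- cell only.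
    refine integral_congr_ae (G.ae_restrict_cell fun x hx => ?_)
    have hx' := G.openCell_subset c hx
    beta_reduce
    rw [topDeriv_eq _ c hx, topDeriv_eq _ c hx, mixedDeriv_interpolant d c _ hx',
      mixedDeriv_cellInterpolant (G.uniqueLineDiffOn_cell c) d c _ hx', Finset.sum_mul]
    exact Finset.sum_congr rfl fun m _ => mul_assoc _ _ _
  rw [hsum, integral_finsetSum _ fun m _ => hint m]
  refine Finset.sum_eq_zero fun m _ => ?_
  rw [integral_const_mul, key m, mul_zero]

lemma stabilityForm_eq_zero (d : DataIndex G k → ℝ) {w : smoothSpace G k N hN}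
    (hw : hermiteDataMap N hN w = 0) :
    stabilityForm G k N hN (interpolantMap N hN d) w = 0 := by
  have hint := integrableOn_topDeriv_mul (interpolant_mem N hN d) w.2
  have hm : ∀ c, NullMeasurableSet (G.cell c) := fun c => measurableSet_Icc.nullMeasurableSet
  have h := integral_iUnion_ae hm G.aedisjoint_cell (hint.mono_set G.domain_eq.ge)
  simp only [setIntegral_cell_eq_zero d hw, tsum_zero] at h
  rwa [← G.domain_eq] at h

end bilinear

end HermiteProj

end

open HermiteProj in
theorem mainTheorem4 (p k : ℕ) (N : ℕ∞) (hN : ((p * (k + 1) : ℕ) : ℕ∞) ≤ N) (G : Grid p) :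
    ∃ (B : LinearMap.BilinForm ℝ (smoothSpace G k N hN))
      (P : smoothSpace G k N hN →ₗ[ℝ] smoothSpace G k N hN),
      (∀ f g : smoothSpace G k N hN,
        MeasureTheory.IntegrableOn (fun x => topDeriv G k f x * topDeriv G k g x) G.domain ∧
        B f g = ∫ x in G.domain, topDeriv G k f x * topDeriv G k g x) ∧
      (∀ f : smoothSpace G k N hN, B f f = stabilityFunctional G k f) ∧
      B.IsPosSemidef ∧
      (∀ (φ : smoothSpace G k N hN) (H : G.domain → ℝ),
        IsHermiteInterpolant G k φ H ↔ H = P φ) ∧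
      IsIdempotentElem P ∧
      (∀ u ∈ LinearMap.range P, ∀ v ∈ LinearMap.ker P, B u v = 0) ∧
      (∀ (f g : smoothSpace G k N hN) (c : (i : Fin p) → Fin (G.size i)),
        ∫ x in G.cell c, topDeriv G k (P f) x * topDeriv G k (g - P g : smoothSpace G k N hN) x
          = 0) := by
  refine ⟨stabilityForm G k N hN, hermiteProj G k N hN,
    fun f g => ⟨integrableOn_topDeriv_mul f.2 g.2, rfl⟩, fun f => ?_, isPosSemidef_stabilityForm,
    fun φ H => isHermiteInterpolant_iff _ H, ?_, ?_, fun f g c => ?_⟩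
  · simp only [stabilityForm_apply, stabilityFunctional, sq]
  · exact LinearMap.ext fun f => congrArg (interpolantMap N hN) (hermiteData_interpolant _)
  · rintro _ ⟨f, rfl⟩ v hv
    refine stabilityForm_eq_zero _ ?_
    -- `P v` has the same data as `v`, so `P v = 0` forces the data of `v` to vanish.
    have h := congrArg (hermiteDataMap N hN) (LinearMap.mem_ker.1 hv)
    rwa [map_zero, hermiteProj, LinearMap.comp_apply, hermiteData_interpolant] at h
  · refine setIntegral_cell_eq_zero (hermiteDataMap N hN f) ?_ c
    rw [map_sub, hermiteProj, LinearMap.comp_apply, hermiteData_interpolant, sub_self]
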